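/- Let $F$ be a non-archimedean local field of characteristic zero with uniformizer $\varpi$, let $F^{\mathrm{un}}$ be its maximal unramified extension, with ring of integers $\mathfrak o$ and maximal ideal $\mathfrak p=\varpi\mathfrak o$, and let $\overline{k_F}=\mathfrak o/\mathfrak p$ be its residue field, an algebraic closure of the residue field of $F$. Let $n\ge 0$ be an integer and let $\Phi=\{e_i-e_j: i\ne j\}$ be the roots of the diagonal torus $\mathrm T$ of $\mathrm{GL}_n$, considered as functions on the apartment $\mathbb R^n$. The affine roots are the functions $\alpha+m$ with $\alpha\in\Phi$ and $m\in\mathbb Z$. For $x\in\mathbb R^n$ and real $r\ge 0$, let $G_{x,r}$ (respectively $G_{x,r^+}$) be the subgroup of $\mathrm{GL}_n(F^{\mathrm{un}})$ generated by $\mathrm T(1+\mathfrak p^{\lceil r\rceil})$ and all $X_\alpha(\mathfrak p^{-\lfloor \alpha(x)-r\rfloor})$ (respectively by $\mathrm T(1+\mathfrak p^{\lfloor r\rfloor+1})$ and all $X_\alpha(\mathfrak p^{1-\lceil \alpha(x)-r\rceil})$), $\alpha\in\Phi$, where $X_{e_i-e_j}(u)=1+uE_{ij}$ and $\mathrm T(1+\mathfrak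 p^0)$ means $\mathrm T(\mathfrak o)$. Let $r(x)$ be the smallest positive value at $x$ of an affine root, let $\mathrm G_x=G_{x,0}/G_{x,0^+}$, and let $\mathrm V_x=G_{x,r(x)}/G_{x,r(x)^+}$, which is a finite-dimensional $\overline{k_F}$-vector space, with scalars acting by $c\cdot[1+X]=[1+cX]$. Let $N:\mathrm G_x\to\mathrm{GL}(\mathrm V_x)$ be the representation induced by conjugation, and let $\check{\mathrm V}_x=\mathrm{Hom}_{\overline{k_F}}(\mathrm V_x,\overline{k_F})$ carry the dual representation. A functional $\lambda\in\check{\mathrm V}_x$ is called stable if its orbit $\mathrm G_x\cdot\lambda$ is Zariski closed in $\check{\mathrm V}_x$ and its stabilizer in $\mathrm G_x$ is finite modulo $\ker N$. Let $\psi_i=e_i-e_{i+1}$ for $1\le i\le n-1$ and $\psi_n=1-(e_1-e_n)$, and let $C=\{x\in\mathbb R^n:\psi_i(x)>0\text{ for all }i\}$ be the standard alcove. A facet of $\overline C$ is a nonempty set of the form $\{x:\psi_i(x)=0\text{ for }i\in J,\ \psi_i(x)>0\text{ for }i\notin J\}$, with $J$ a set of indices; it is proper if it is different from $C$. A barycenter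 of a facet $\mathcal F$ is a point of $\mathcal F$ at which all the $\psi_i$ that do not vanish on $\mathcal F$ take the same value. Theorem. If $\overline x$ is a barycenter of a proper facet $\mathcal F$ of $\overline C$, then $\check{\mathrm V}_{\overline x}$ has no stable functionals. -/

import Mathlib

set_option linter.unusedSectionVars false

open scoped Matrix ValuativeRel

namespace MoyPrasad

noncomputable section Generic

variable {O E ι : Type*} [CommRing O] [Field E] [Algebra O E] [Fintype ι] [DecidableEq ι]

/-- The fractional ideal `𝔭 ^ m = ϖ ^ m O` of `E`, for an integer `m`, where `ϖ` generates `𝔭`. -/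
def fracPow (E : Type*) [Field E] [Algebra O E] (ϖ : O) (m : ℤ) : Submodule O E :=
  Submodule.span O {algebraMap O E ϖ ^ m}

/-- The two elementary facts on `ϖ` used to set up the filtrations: it is nonzero in `E` and lies in
the Jacobson radical of `O`. For a uniformizer of a local field `F`, inside the ring of integers of
the maximal unramified extension of `F`, this is proved below. -/
class IsPseudoUniformizer (E : Type*) [Field E] [Algebra O E] (ϖ : O) : Prop where
  map_ne_zero : algebraMap O E ϖ ≠ 0
  isUnit_one_add_mul : ∀ c : O, IsUnit (1 + ϖ * c)

/-- The `O`-lattice of matrices whose `(i, j)` entry lies in `𝔭 ^ (a i j)`. -/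
def latticeOf (E : Type*) [Field E] [Algebra O E] (ϖ : O) (a : ι → ι → ℤ) :
    Submodule O (Matrix ι ι E) where
  carrier := {X | ∀ i j, X i j ∈ fracPow E ϖ (a i j)}
  zero_mem' := fun _ _ => Submodule.zero_mem _
  add_mem' := fun hX hY i j => Submodule.add_mem _ (hX i j) (hY i j)
  smul_mem' := fun c _ hX i j => Submodule.smul_mem _ c (hX i j)

/-- The group `T(1 + 𝔭 ^ m)` of diagonal matrices with entries in `Oˣ` congruent to `1` modulo
`𝔭 ^ m`, as a subset of `GL`; for `m = 0` it is `T(O)`, the diagonal matrices with entries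
in `Oˣ`. -/
def torusGen (E : Type*) [Field E] [Algebra O E] (ι : Type*) [Fintype ι] [DecidableEq ι]
    (ϖ : O) (m : ℤ) : Set (GL ι E) :=
  {g | ∃ u : ι → Oˣ, (∀ i, algebraMap O E (u i) - 1 ∈ fracPow E ϖ m) ∧
    (g : Matrix ι ι E) = Matrix.diagonal fun i => algebraMap O E (u i)}

/-- The union over the roots `α = e_i - e_j` of `GL` of the subgroups `X_α(𝔭 ^ (a i j))`, where
`X_α(u) = 1 + u E_ij`. -/
def rootGen (E : Type*) [Field E] [Algebra O E] {ι : Type*} [Fintype ι] [DecidableEq ι]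
    (ϖ : O) (a : ι → ι → ℤ) : Set (GL ι E) :=
  {g | ∃ i j : ι, i ≠ j ∧ ∃ u ∈ fracPow E ϖ (a i j),
    (g : Matrix ι ι E) = Matrix.transvection i j u}

/-- The subgroup of `GL(E)` generated by `T(1 + 𝔭 ^ m)` and by the root subgroups
`X_α(𝔭 ^ (a i j))`, for `α = e_i - e_j` with `i ≠ j`. -/
def groupOf (E : Type*) [Field E] [Algebra O E] {ι : Type*} [Fintype ι] [DecidableEq ι]
    (ϖ : O) (m : ℤ) (a : ι → ι → ℤ) : Subgroup (GL ι E) :=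
  Subgroup.closure (torusGen E ι ϖ m ∪ rootGen E ϖ a)

variable {ϖ : O}

theorem mem_fracPow {m : ℤ} {z : E} :
    z ∈ fracPow E ϖ m ↔ ∃ c : O, algebraMap O E c * algebraMap O E ϖ ^ m = z := by
  simp [fracPow, Submodule.mem_span_singleton, Algebra.smul_def]

theorem algebraMap_mem_fracPow (c : O) : algebraMap O E c ∈ fracPow E ϖ 0 :=
  mem_fracPow.2 ⟨c, by simp⟩

theorem fracPow_mul [IsPseudoUniformizer E ϖ] {m k : ℤ} {y z : E}
    (hy : y ∈ fracPow E ϖ m) (hz : z ∈ fracPow E ϖ k) : y * z ∈ fracPow E ϖ (m + k) := by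
  obtain ⟨c, rfl⟩ := mem_fracPow.1 hy
  obtain ⟨d, rfl⟩ := mem_fracPow.1 hz
  refine mem_fracPow.2 ⟨c * d, ?_⟩
  rw [zpow_add₀ (IsPseudoUniformizer.map_ne_zero (E := E) (ϖ := ϖ)), map_mul]
  ring

theorem fracPow_anti [IsPseudoUniformizer E ϖ] {m k : ℤ} (h : m ≤ k) :
    fracPow E ϖ k ≤ fracPow E ϖ m := by
  intro z hz
  obtain ⟨c, rfl⟩ := mem_fracPow.1 hz
  obtain ⟨l, rfl⟩ := Int.le.dest h
  refine mem_fracPow.2 ⟨c * ϖ ^ l, ?_⟩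
  rw [zpow_add₀ (IsPseudoUniformizer.map_ne_zero (E := E) (ϖ := ϖ)), map_mul, map_pow,
    zpow_natCast]
  ring

theorem exists_unit [IsPseudoUniformizer E ϖ] {m : ℤ} (hm : 1 ≤ m) {z : E}
    (hz : z ∈ fracPow E ϖ m) : ∃ u : Oˣ, algebraMap O E u = 1 + z := by
  obtain ⟨c, rfl⟩ := mem_fracPow.1 (fracPow_anti hm hz)
  obtain ⟨u, hu⟩ := IsPseudoUniformizer.isUnit_one_add_mul E (ϖ := ϖ) c
  exact ⟨u, by simp [hu, mul_comm]⟩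

theorem unit_inv_mem {m : ℤ} {u : Oˣ} (hu : algebraMap O E u - 1 ∈ fracPow E ϖ m) :
    algebraMap O E ↑(u⁻¹) - 1 ∈ fracPow E ϖ m := by
  have h : algebraMap O E ↑(u⁻¹) - 1 = (-(↑(u⁻¹) : O)) • (algebraMap O E u - 1) := by
    rw [Algebra.smul_def, mul_sub, ← map_mul]
    simp
    ring
  rw [h]
  exact Submodule.smul_mem _ _ hu

theorem lattice_mul [IsPseudoUniformizer E ϖ] {a b c : ι → ι → ℤ}
    (h : ∀ i j k, c i k ≤ a i j + b j k) {X Y : Matrix ι ι E}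
    (hX : X ∈ latticeOf E ϖ a) (hY : Y ∈ latticeOf E ϖ b) : X * Y ∈ latticeOf E ϖ c := by
  intro i k
  rw [Matrix.mul_apply]
  exact Submodule.sum_mem _ fun j _ => fracPow_anti (h i j k) (fracPow_mul (hX i j) (hY j k))

theorem sub_one_mem_of_mem_groupOf [IsPseudoUniformizer E ϖ] {m : ℤ} {a : ι → ι → ℤ}
    (hsub : ∀ i j k, a i k ≤ a i j + a j k) (hdiag : ∀ i, a i i = m)
    {g : GL ι E} (hg : g ∈ groupOf E ϖ m a) :
    (g : Matrix ι ι E) - 1 ∈ latticeOf E ϖ a ∧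
      (↑g⁻¹ : Matrix ι ι E) - 1 ∈ latticeOf E ϖ a := by
  have hmul : ∀ g h : Matrix ι ι E, g - 1 ∈ latticeOf E ϖ a → h - 1 ∈ latticeOf E ϖ a →
      g * h - 1 ∈ latticeOf E ϖ a := by
    intro g h hg hh
    have : g * h - 1 = (g - 1) * (h - 1) + (g - 1) + (h - 1) := by noncomm_ring
    rw [this]
    exact Submodule.add_mem _ (Submodule.add_mem _ (lattice_mul hsub hg hh) hg) hh
  have hd : ∀ u : ι → Oˣ, (∀ i, algebraMap O E (u i) - 1 ∈ fracPow E ϖ m) →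
      (Matrix.diagonal (fun i => algebraMap O E (u i)) : Matrix ι ι E) - 1 ∈
        latticeOf E ϖ a := by
    intro u hu i j
    by_cases hij : i = j
    · subst hij
      simpa [hdiag] using hu i
    · simp [hij]
  have ht : ∀ i j : ι, i ≠ j → ∀ u ∈ fracPow E ϖ (a i j),
      Matrix.transvection i j u - 1 ∈ latticeOf E ϖ a := by
    intro i j _ u hu k l
    simp only [Matrix.transvection, add_sub_cancel_left, Matrix.single_apply]
    split_ifs with h
    · obtain ⟨rfl, rfl⟩ := h
      exact hu
    · exact Submodule.zero_mem _
  induction hg using Subgroup.closure_induction with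
  | mem g hg =>
    rcases hg with ⟨u, hu, hg⟩ | ⟨i, j, hij, u, hu, hg⟩
    · refine ⟨hg ▸ hd u hu, ?_⟩
      have : (↑g⁻¹ : Matrix ι ι E) =
          Matrix.diagonal (fun i => algebraMap O E (↑(u i)⁻¹ : O)) := by
        rw [Matrix.coe_units_inv, hg]
        refine Matrix.inv_eq_right_inv ?_
        rw [Matrix.diagonal_mul_diagonal, ← Matrix.diagonal_one]
        congr 1
        funext i
        rw [← map_mul]
        simp
      rw [this]
      exact hd (fun i => (u i)⁻¹) fun i => unit_inv_mem (hu i)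
    · refine ⟨hg ▸ ht i j hij u hu, ?_⟩
      have : (↑g⁻¹ : Matrix ι ι E) = Matrix.transvection i j (-u) := by
        rw [Matrix.coe_units_inv, hg]
        refine Matrix.inv_eq_right_inv ?_
        rw [Matrix.transvection_mul_transvection_same _ _ hij]
        simp
      rw [this]
      exact ht i j hij _ (Submodule.neg_mem _ hu)
  | one => simp
  | mul g h _ _ hg hh =>
    refine ⟨?_, ?_⟩
    · simpa using hmul _ _ hg.1 hh.1
    · rw [mul_inv_rev]
      simpa using hmul _ _ hh.2 hg.2
  | inv g _ hg => exact ⟨hg.2, by simpa using hg.1⟩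

theorem exists_col (p : ι) {m : ℤ} {a : ι → ι → ℤ} (s : Finset ι) : ∀ c : ι → E,
    (∀ j, j ∉ s → c j = 0) → c p = 0 → (∀ j, c j ∈ fracPow E ϖ (a j p)) →
    ∃ g ∈ groupOf E ϖ m a, (g : Matrix ι ι E) = 1 + Matrix.vecMulVec c (Pi.single p 1) := by
  induction s using Finset.induction_on with
  | empty =>
    intro c hc _ _
    have : c = 0 := funext fun j => hc j (by simp)
    exact ⟨1, Subgroup.one_mem _, by simp [this]⟩
  | insert q s hq ih =>
    intro c hc hp ha
    obtain ⟨g, hg, hg'⟩ := ih (Function.update c q 0)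
      (fun j hj => by
        by_cases hjq : j = q
        · simp [hjq]
        · simpa [hjq] using hc j (by simp [hjq, hj]))
      (by by_cases hpq : p = q
          · simp [hpq]
          · simpa [hpq] using hp)
      (fun j => by
        by_cases hjq : j = q
        · simp [hjq]
        · simpa [hjq] using ha j)
    by_cases hpq : q = p
    · refine ⟨g, hg, ?_⟩
      rw [hg']
      congr 2
      funext j
      by_cases hjq : j = q
      · simp [hjq, hpq, hp]
      · simp [hjq]
    · let t : GL ι E := ⟨Matrix.transvection q p (c q), Matrix.transvection q p (-c q),
        by rw [Matrix.transvection_mul_transvection_same _ _ hpq]; simp,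
        by rw [Matrix.transvection_mul_transvection_same _ _ hpq]; simp⟩
      refine ⟨g * t, Subgroup.mul_mem _ hg (Subgroup.subset_closure
        (Or.inr ⟨q, p, hpq, c q, ha q, rfl⟩)), ?_⟩
      have ht : (t : Matrix ι ι E) = 1 + Matrix.single q p (c q) := rfl
      rw [Units.val_mul, hg', ht, mul_add, mul_one, add_mul, one_mul]
      have h0 : Matrix.vecMulVec (Function.update c q 0) (Pi.single p (1 : E)) *
          Matrix.single q p (c q) = 0 := by
        ext i j
        rw [Matrix.mul_apply]
        refine Finset.sum_eq_zero fun k _ => ?_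
        rcases eq_or_ne q k with rfl | hk
        · simp [Matrix.vecMulVec_apply, hpq]
        · simp [hk]
      rw [h0, add_zero, add_assoc]
      congr 1
      ext i j
      simp only [Matrix.add_apply, Matrix.vecMulVec_apply, Matrix.single_apply,
        Function.update_apply, Pi.single_apply]
      rcases eq_or_ne j p with rfl | h2
      · rcases eq_or_ne i q with rfl | h1
        · simp
        · simp [h1, h1.symm]
      · simp [h2, h2.symm]

theorem exists_row (p : ι) {m : ℤ} {a : ι → ι → ℤ} (s : Finset ι) : ∀ c : ι → E,
    (∀ j, j ∉ s → c j = 0) → c p = 0 → (∀ j, c j ∈ fracPow E ϖ (a p j)) →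
    ∃ g ∈ groupOf E ϖ m a, (g : Matrix ι ι E) = 1 + Matrix.vecMulVec (Pi.single p 1) c := by
  induction s using Finset.induction_on with
  | empty =>
    intro c hc _ _
    have : c = 0 := funext fun j => hc j (by simp)
    exact ⟨1, Subgroup.one_mem _, by simp [this]⟩
  | insert q s hq ih =>
    intro c hc hp ha
    obtain ⟨g, hg, hg'⟩ := ih (Function.update c q 0)
      (fun j hj => by
        by_cases hjq : j = q
        · simp [hjq]
        · simpa [hjq] using hc j (by simp [hjq, hj]))
      (by by_cases hpq : p = q
          · simp [hpq]
          · simpa [hpq] using hp)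
      (fun j => by
        by_cases hjq : j = q
        · simp [hjq]
        · simpa [hjq] using ha j)
    by_cases hpq : q = p
    · refine ⟨g, hg, ?_⟩
      rw [hg']
      congr 2
      funext j
      by_cases hjq : j = q
      · simp [hjq, hpq, hp]
      · simp [hjq]
    · have hpq' : p ≠ q := fun h => hpq h.symm
      let t : GL ι E := ⟨Matrix.transvection p q (c q), Matrix.transvection p q (-c q),
        by rw [Matrix.transvection_mul_transvection_same _ _ hpq']; simp,
        by rw [Matrix.transvection_mul_transvection_same _ _ hpq']; simp⟩
      refine ⟨t * g, Subgroup.mul_mem _ (Subgroup.subset_closure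
        (Or.inr ⟨p, q, hpq', c q, ha q, rfl⟩)) hg, ?_⟩
      have ht : (t : Matrix ι ι E) = 1 + Matrix.single p q (c q) := rfl
      rw [Units.val_mul, hg', ht, add_mul, one_mul, mul_add, mul_one]
      have h0 : Matrix.single p q (c q) *
          Matrix.vecMulVec (Pi.single p (1 : E)) (Function.update c q 0) = 0 := by
        ext i j
        rw [Matrix.mul_apply]
        refine Finset.sum_eq_zero fun k _ => ?_
        rcases eq_or_ne q k with rfl | hk
        · simp [Matrix.vecMulVec_apply, hpq]
        · simp [hk]
      rw [h0, add_zero, add_assoc]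
      congr 1
      ext i j
      simp only [Matrix.add_apply, Matrix.vecMulVec_apply, Matrix.single_apply,
        Function.update_apply, Pi.single_apply]
      rcases eq_or_ne i p with rfl | h2
      · rcases eq_or_ne j q with rfl | h1
        · simp
        · simp [h1, h1.symm]
      · simp [h2, h2.symm]

theorem exists_mem_groupOf [IsPseudoUniformizer E ϖ] {m : ℤ} {a : ι → ι → ℤ} (hm : 1 ≤ m)
    (hsub : ∀ i j k, a i k ≤ a i j + a j k) (hdiag : ∀ i, a i i = m) (s : Finset ι) :
    ∀ X ∈ latticeOf E ϖ a, (∀ i j, i ∉ s ∨ j ∉ s → X i j = 0) →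
    ∃ g ∈ groupOf E ϖ m a, (g : Matrix ι ι E) = 1 + X := by
  induction s using Finset.induction_on with
  | empty =>
    intro X _ hX
    have : X = 0 := by ext i j; exact hX i j (by simp)
    exact ⟨1, Subgroup.one_mem _, by simp [this]⟩
  | insert p s hp ih =>
    intro X hL hX
    obtain ⟨u, hu⟩ := exists_unit (E := E) (ϖ := ϖ) hm (hdiag p ▸ hL p p)
    set v : E := algebraMap O E u with hv
    have hv0 : v ≠ 0 := (u.isUnit.map (algebraMap O E)).ne_zero
    have hvinv : v⁻¹ = algebraMap O E ↑(u⁻¹) := by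
      refine inv_eq_of_mul_eq_one_right ?_
      rw [hv, ← map_mul]
      simp
    have hsm : ∀ {l : ℤ} {z : E}, z ∈ fracPow E ϖ l → v⁻¹ * z ∈ fracPow E ϖ l := by
      intro l z hz
      rw [hvinv, ← Algebra.smul_def]
      exact Submodule.smul_mem _ _ hz
    let c : ι → E := fun j => if j = p then 0 else v⁻¹ * X j p
    let d : ι → E := fun k => if k = p then 0 else v⁻¹ * X p k
    let Y : Matrix ι ι E := fun j k =>
      if j = p ∨ k = p then 0 else X j k - v⁻¹ * (X j p * X p k)
    obtain ⟨g₁, hg₁, h₁⟩ := exists_col (E := E) (ϖ := ϖ) p (m := m) (a := a) Finset.univ c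
      (by simp) (by simp [c]) (fun j => by
        by_cases h : j = p
        · simp [c, h]
        · simpa [c, h] using hsm (hL j p))
    obtain ⟨g₂, hg₂, h₂⟩ := exists_row (E := E) (ϖ := ϖ) p (m := m) (a := a) Finset.univ d
      (by simp) (by simp [d]) (fun j => by
        by_cases h : j = p
        · simp [d, h]
        · simpa [d, h] using hsm (hL p j))
    obtain ⟨g₃, hg₃, h₃⟩ := ih Y (fun i j => by
        by_cases h : i = p ∨ j = p
        · simp [Y, h]
        · simp only [Y, h, if_false]
          exact Submodule.sub_mem _ (hL i j)
            (hsm (fracPow_anti (hsub i p j) (fracPow_mul (hL i p) (hL p j)))))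
      (fun i j hij => by
        by_cases h : i = p ∨ j = p
        · simp [Y, h]
        · push Not at h
          simp only [Y, h.1, h.2, or_self, if_false]
          have h1 : i ∉ insert p s ∨ j ∉ insert p s := by
            simpa [h.1, h.2] using hij
          have h2 : X i p * X p j = 0 := by
            rcases h1 with h1 | h1
            · rw [hX i p (Or.inl h1), zero_mul]
            · rw [hX p j (Or.inr h1), mul_zero]
          rw [hX i j h1, h2]
          simp)
    let w : ι → Oˣ := Function.update 1 p u
    have hw : ∀ i, algebraMap O E (w i) - 1 ∈ fracPow E ϖ m := by
      intro i
      by_cases h : i = p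
      · subst h
        simpa [w, ← hv, hu, hdiag] using hL i i
      · simp [w, h]
    let t : GL ι E :=
      ⟨Matrix.diagonal fun i => algebraMap O E (w i),
        Matrix.diagonal fun i => algebraMap O E ↑(w i)⁻¹,
        by
          rw [Matrix.diagonal_mul_diagonal, ← Matrix.diagonal_one]
          congr 1
          funext i
          rw [← map_mul]
          simp,
        by
          rw [Matrix.diagonal_mul_diagonal, ← Matrix.diagonal_one]
          congr 1
          funext i
          rw [← map_mul]
          simp⟩
    have ht : t ∈ groupOf E ϖ m a :=
      Subgroup.subset_closure (Or.inl ⟨w, hw, rfl⟩)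
    have ht' : (t : Matrix ι ι E) = 1 + Matrix.single p p (X p p) := by
      ext i j
      change Matrix.diagonal (fun i => algebraMap O E (w i)) i j = _
      rcases eq_or_ne i j with rfl | hij
      · rcases eq_or_ne i p with rfl | hi
        · simp [w, ← hv, hu]
        · simp [w, hi, hi.symm]
      · rw [Matrix.diagonal_apply_ne _ hij, Matrix.add_apply, Matrix.one_apply_ne hij,
          Matrix.single_apply_of_ne]
        · simp
        · rintro ⟨rfl, rfl⟩
          exact hij rfl
    refine ⟨g₁ * (t * g₃) * g₂, Subgroup.mul_mem _ (Subgroup.mul_mem _ hg₁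
      (Subgroup.mul_mem _ ht hg₃)) hg₂, ?_⟩
    rw [Units.val_mul, Units.val_mul, Units.val_mul, h₁, h₂, h₃, ht']
    have e1 : Matrix.single p p (X p p) * Y = 0 := by
      ext i j
      rw [Matrix.mul_apply]
      refine Finset.sum_eq_zero fun k _ => ?_
      rcases eq_or_ne p k with rfl | hk
      · simp [Y]
      · simp [hk]
    have e2 : Matrix.vecMulVec c (Pi.single p 1) * Y = 0 := by
      ext i j
      rw [Matrix.mul_apply]
      refine Finset.sum_eq_zero fun k _ => ?_
      rcases eq_or_ne k p with rfl | hk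
      · simp [Y]
      · simp [Matrix.vecMulVec_apply, hk]
    have e3 : Y * Matrix.vecMulVec (Pi.single p 1) d = 0 := by
      ext i j
      rw [Matrix.mul_apply]
      refine Finset.sum_eq_zero fun k _ => ?_
      rcases eq_or_ne k p with rfl | hk
      · simp [Y]
      · simp [Matrix.vecMulVec_apply, hk]
    have e4 : Matrix.vecMulVec c (Pi.single p 1) * Matrix.single p p (X p p) =
        X p p • Matrix.vecMulVec c (Pi.single p 1) := by
      ext i j
      rw [Matrix.mul_apply, Finset.sum_eq_single p]
      · rcases eq_or_ne p j with rfl | hj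
        · simp [Matrix.vecMulVec_apply, mul_comm]
        · simp [Matrix.vecMulVec_apply, hj, hj.symm]
      · intro k _ hk
        simp [Matrix.vecMulVec_apply, hk]
      · simp
    have e5 : Matrix.single p p (X p p) * Matrix.vecMulVec (Pi.single p 1) d =
        X p p • Matrix.vecMulVec (Pi.single p 1) d := by
      ext i j
      rw [Matrix.mul_apply, Finset.sum_eq_single p]
      · rcases eq_or_ne p i with rfl | hj
        · simp [Matrix.vecMulVec_apply]
        · simp [Matrix.vecMulVec_apply, hj, hj.symm]
      · intro k _ hk
        simp [Matrix.vecMulVec_apply, hk]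
      · simp
    have e6 : Matrix.vecMulVec c (Pi.single p 1) * Matrix.vecMulVec (Pi.single p 1) d =
        Matrix.vecMulVec c d := by
      ext i j
      rw [Matrix.mul_apply, Finset.sum_eq_single p]
      · simp [Matrix.vecMulVec_apply]
      · intro k _ hk
        simp [Matrix.vecMulVec_apply, hk]
      · simp
    have key : (1 + Matrix.vecMulVec c (Pi.single p 1)) *
          ((1 + Matrix.single p p (X p p)) * (1 + Y)) *
          (1 + Matrix.vecMulVec (Pi.single p 1) d) =
        1 + Y + Matrix.single p p (X p p) + v • Matrix.vecMulVec c (Pi.single p 1) +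
          v • Matrix.vecMulVec (Pi.single p 1) d + v • Matrix.vecMulVec c d := by
      have s1 : (1 + Matrix.single p p (X p p)) * (1 + Y) =
          1 + Y + Matrix.single p p (X p p) := by
        rw [add_mul, one_mul, mul_add, mul_one, e1, add_zero]
      have s2 : (1 + Matrix.vecMulVec c (Pi.single p 1)) *
          (1 + Y + Matrix.single p p (X p p)) =
          1 + Y + Matrix.single p p (X p p) + v • Matrix.vecMulVec c (Pi.single p 1) := by
        rw [add_mul, one_mul, mul_add, mul_add, mul_one, e2, e4, hu, add_zero, add_smul, one_smul]
      rw [s1, s2, mul_add, mul_one, add_mul, add_mul, add_mul, one_mul, e3, e5, smul_mul_assoc,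
        e6, hu]
      module
    have hY : ∀ i j, Y i j =
        if i = p ∨ j = p then 0 else X i j - v⁻¹ * (X i p * X p j) := fun _ _ => rfl
    rw [key]
    ext i j
    simp only [Matrix.add_apply, Matrix.smul_apply, Matrix.vecMulVec_apply, smul_eq_mul,
      Matrix.single_apply, Pi.single_apply, c, d, hY]
    rcases eq_or_ne i p with rfl | hi
    · rcases eq_or_ne j i with rfl | hj
      · simp
      · simp [hj, hj.symm, hv0]
    · rcases eq_or_ne j p with rfl | hj
      · simp [hi, hi.symm, hv0]
      · simp only [hi, hj, hi.symm, or_self, false_and, if_false]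
        field_simp
        ring

theorem mem_groupOf_iff [IsPseudoUniformizer E ϖ] {m : ℤ} {a : ι → ι → ℤ} (hm : 1 ≤ m)
    (hsub : ∀ i j k, a i k ≤ a i j + a j k) (hdiag : ∀ i, a i i = m) {g : GL ι E} :
    g ∈ groupOf E ϖ m a ↔ (g : Matrix ι ι E) - 1 ∈ latticeOf E ϖ a := by
  refine ⟨fun h => (sub_one_mem_of_mem_groupOf hsub hdiag h).1, fun h => ?_⟩
  obtain ⟨g', hg', h'⟩ := exists_mem_groupOf hm hsub hdiag Finset.univ _ h (by simp)
  have : g = g' := Units.ext (by rw [h']; abel)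
  exact this ▸ hg'


/-- The exponent `-⌊α(x) - r⌋` for `α = e_i - e_j`. On the diagonal (`α = 0`) it is `⌈r⌉`. -/
def expo (x : ι → ℝ) (r : ℝ) (i j : ι) : ℤ := -⌊x i - x j - r⌋

/-- The exponent `1 - ⌈α(x) - r⌉` for `α = e_i - e_j`. On the diagonal it is `⌊r⌋ + 1`. -/
def expoPlus (x : ι → ℝ) (r : ℝ) (i j : ι) : ℤ := 1 - ⌈x i - x j - r⌉

/-- The Moy--Prasad group `G_{x,r}`, for `r ≥ 0`: it is generated by `T(1 + 𝔭 ^ ⌈r⌉)` and by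
`X_α(𝔭 ^ (-⌊α(x) - r⌋))` for all roots `α`. -/
def filt (E : Type*) [Field E] [Algebra O E] (ϖ : O) (x : ι → ℝ) (r : ℝ) : Subgroup (GL ι E) :=
  groupOf E ϖ ⌈r⌉ (expo x r)

/-- The Moy--Prasad group `G_{x,r+}`, for `r ≥ 0`: it is generated by `T(1 + 𝔭 ^ (⌊r⌋ + 1))` and by
`X_α(𝔭 ^ (1 - ⌈α(x) - r⌉))` for all roots `α`. -/
def filtPlus (E : Type*) [Field E] [Algebra O E] (ϖ : O) (x : ι → ℝ) (r : ℝ) :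
    Subgroup (GL ι E) :=
  groupOf E ϖ (⌊r⌋ + 1) (expoPlus x r)

/-- The Moy--Prasad lattice `𝔤_{x,r}` in the Lie algebra of `GL`. -/
def lie (E : Type*) [Field E] [Algebra O E] (ϖ : O) (x : ι → ℝ) (r : ℝ) :
    Submodule O (Matrix ι ι E) :=
  latticeOf E ϖ (expo x r)

/-- The Moy--Prasad lattice `𝔤_{x,r+}` in the Lie algebra of `GL`. -/
def liePlus (E : Type*) [Field E] [Algebra O E] (ϖ : O) (x : ι → ℝ) (r : ℝ) :
    Submodule O (Matrix ι ι E) :=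
  latticeOf E ϖ (expoPlus x r)

theorem expo_add (x : ι → ℝ) {r s t : ℝ} (h : t ≤ r + s) (i j k : ι) :
    expo x t i k ≤ expo x r i j + expo x s j k := by
  have h1 := Int.le_floor_add (x i - x j - r) (x j - x k - s)
  have h2 : ⌊x i - x j - r + (x j - x k - s)⌋ ≤ ⌊x i - x k - t⌋ :=
    Int.floor_mono (by linarith)
  simp only [expo]
  omega

theorem expo_add_left (x : ι → ℝ) {r s t : ℝ} (h : t ≤ r + s) (i j k : ι) :
    expoPlus x t i k ≤ expoPlus x r i j + expo x s j k := by
  have h2 : ⌈x i - x j - r⌉ + ⌊x j - x k - s⌋ ≤ ⌈x i - x k - t⌉ := by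
    rw [← Int.ceil_add_intCast]
    exact Int.ceil_mono (by linarith [Int.floor_le (x j - x k - s)])
  simp only [expo, expoPlus]
  omega

theorem expo_add_right (x : ι → ℝ) {r s t : ℝ} (h : t ≤ r + s) (i j k : ι) :
    expoPlus x t i k ≤ expo x r i j + expoPlus x s j k := by
  have h2 : ⌊x i - x j - r⌋ + ⌈x j - x k - s⌉ ≤ ⌈x i - x k - t⌉ := by
    rw [← Int.ceil_intCast_add]
    exact Int.ceil_mono (by linarith [Int.floor_le (x i - x j - r)])
  simp only [expo, expoPlus]
  omega

theorem expo_le_expoPlus (x : ι → ℝ) (r : ℝ) (i j : ι) : expo x r i j ≤ expoPlus x r i j := by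
  have := Int.ceil_le_floor_add_one (x i - x j - r)
  simp only [expo, expoPlus]
  omega

theorem expoPlus_le_expo (x : ι → ℝ) {r s : ℝ} (h : r < s) (i j : ι) :
    expoPlus x r i j ≤ expo x s i j := by
  have : ⌊x i - x j - s⌋ + 1 ≤ ⌈x i - x j - r⌉ := by
    rw [Int.add_one_le_iff, Int.lt_ceil]
    linarith [Int.floor_le (x i - x j - s)]
  simp only [expo, expoPlus]
  omega

theorem expo_diag (x : ι → ℝ) (r : ℝ) (i : ι) : expo x r i i = ⌈r⌉ := by
  simp [expo, Int.floor_neg]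

theorem expoPlus_diag (x : ι → ℝ) (r : ℝ) (i : ι) : expoPlus x r i i = ⌊r⌋ + 1 := by
  simp [expoPlus, Int.ceil_neg]
  ring

theorem expoPlus_sub (x : ι → ℝ) {r : ℝ} (h : 0 ≤ r) (i j k : ι) :
    expoPlus x r i k ≤ expoPlus x r i j + expoPlus x r j k :=
  (expo_add_left x (r := r) (s := r) (by linarith) i j k).trans
    (by linarith [expo_le_expoPlus x r j k])

section

variable [IsPseudoUniformizer E ϖ] {x : ι → ℝ} {r s t : ℝ}

theorem lattice_anti {a b : ι → ι → ℤ} (h : ∀ i j, a i j ≤ b i j) :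
    latticeOf E ϖ b ≤ latticeOf E ϖ a := fun _ hX i j => fracPow_anti (h i j) (hX i j)

theorem liePlus_le_lie : liePlus E ϖ x r ≤ lie E ϖ x r :=
  lattice_anti (expo_le_expoPlus x r)

/-- For `r > 0`, the group `G_{x,r}` is `1 + 𝔤_{x,r}`. -/
theorem mem_filt_iff (hr : 0 < r) {g : GL ι E} :
    g ∈ filt E ϖ x r ↔ (g : Matrix ι ι E) - 1 ∈ lie E ϖ x r :=
  mem_groupOf_iff (Int.one_le_ceil_iff.2 hr) (expo_add x (by linarith)) (expo_diag x r)

/-- For `r ≥ 0`, the group `G_{x,r+}` is `1 + 𝔤_{x,r+}`. -/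
theorem mem_filtPlus_iff (hr : 0 ≤ r) {g : GL ι E} :
    g ∈ filtPlus E ϖ x r ↔ (g : Matrix ι ι E) - 1 ∈ liePlus E ϖ x r :=
  mem_groupOf_iff (by linarith [Int.floor_nonneg.2 hr]) (expoPlus_sub x hr) (expoPlus_diag x r)

theorem exists_filt (hr : 0 < r) {X : Matrix ι ι E} (hX : X ∈ lie E ϖ x r) :
    ∃ g ∈ filt E ϖ x r, (g : Matrix ι ι E) = 1 + X :=
  exists_mem_groupOf (Int.one_le_ceil_iff.2 hr) (expo_add x (by linarith)) (expo_diag x r)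
    Finset.univ X hX (by simp)

theorem one_mem_lie : (1 : Matrix ι ι E) ∈ lie E ϖ x 0 := by
  intro i j
  rcases eq_or_ne i j with rfl | h
  · rw [expo_diag, Matrix.one_apply_eq]
    simpa using algebraMap_mem_fracPow (E := E) (ϖ := ϖ) 1
  · rw [Matrix.one_apply_ne h]
    exact Submodule.zero_mem _

theorem mem_lie_of_mem_filt_zero {g : GL ι E} (hg : g ∈ filt E ϖ x 0) :
    (g : Matrix ι ι E) ∈ lie E ϖ x 0 ∧ (↑g⁻¹ : Matrix ι ι E) ∈ lie E ϖ x 0 := by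
  obtain ⟨h1, h2⟩ := sub_one_mem_of_mem_groupOf (expo_add x (by simp)) (expo_diag x 0) hg
  have h3 := Submodule.add_mem (lie E ϖ x 0) h1 one_mem_lie
  have h4 := Submodule.add_mem (lie E ϖ x 0) h2 one_mem_lie
  rw [sub_add_cancel] at h3 h4
  exact ⟨h3, h4⟩

theorem lie_mul (h : t ≤ r + s) {X Y : Matrix ι ι E} (hX : X ∈ lie E ϖ x r)
    (hY : Y ∈ lie E ϖ x s) : X * Y ∈ lie E ϖ x t := lattice_mul (expo_add x h) hX hY

theorem liePlus_mul (h : t ≤ r + s) {X Y : Matrix ι ι E} (hX : X ∈ liePlus E ϖ x r)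
    (hY : Y ∈ lie E ϖ x s) : X * Y ∈ liePlus E ϖ x t := lattice_mul (expo_add_left x h) hX hY

theorem lie_mul_plus (h : t ≤ r + s) {X Y : Matrix ι ι E} (hX : X ∈ lie E ϖ x r)
    (hY : Y ∈ liePlus E ϖ x s) : X * Y ∈ liePlus E ϖ x t :=
  lattice_mul (expo_add_right x h) hX hY

theorem lie_le_liePlus (h : r < s) : lie E ϖ x s ≤ liePlus E ϖ x r :=
  lattice_anti (expoPlus_le_expo x h)

theorem smul_lie_le {X : Matrix ι ι E} (hX : X ∈ lie E ϖ x r) : ϖ • X ∈ liePlus E ϖ x r := by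
  intro i j
  have h : algebraMap O E ϖ ∈ fracPow E ϖ 1 := mem_fracPow.2 ⟨1, by simp⟩
  rw [Matrix.smul_apply, Algebra.smul_def]
  refine fracPow_anti ?_ (fracPow_mul h (hX i j))
  have := Int.floor_le_ceil (x i - x j - r)
  simp only [expo, expoPlus]
  omega

theorem conj_sub_one (g h : GL ι E) :
    (↑(g * h * g⁻¹) : Matrix ι ι E) - 1 =
      (g : Matrix ι ι E) * ((h : Matrix ι ι E) - 1) * (↑g⁻¹ : Matrix ι ι E) := by
  rw [mul_sub, sub_mul, mul_one, Units.mul_inv, Units.val_mul, Units.val_mul]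

theorem conj_mem_filt (hr : 0 < r) {g h : GL ι E} (hg : g ∈ filt E ϖ x 0)
    (hh : h ∈ filt E ϖ x r) : g * h * g⁻¹ ∈ filt E ϖ x r := by
  rw [mem_filt_iff hr] at hh ⊢
  obtain ⟨h1, h2⟩ := mem_lie_of_mem_filt_zero hg
  rw [conj_sub_one]
  exact lie_mul (by simp) (lie_mul (r := 0) (t := r) (by simp) h1 hh) h2

theorem conj_mem_filtPlus (hr : 0 ≤ r) {g h : GL ι E} (hg : g ∈ filt E ϖ x 0)
    (hh : h ∈ filtPlus E ϖ x r) : g * h * g⁻¹ ∈ filtPlus E ϖ x r := by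
  rw [mem_filtPlus_iff hr] at hh ⊢
  obtain ⟨h1, h2⟩ := mem_lie_of_mem_filt_zero hg
  rw [conj_sub_one]
  exact liePlus_mul (by simp) (lie_mul_plus (r := 0) (t := r) (by simp) h1 hh) h2

theorem filtPlus_le_filt (hr : 0 < r) : filtPlus E ϖ x r ≤ filt E ϖ x r := by
  intro g hg
  rw [mem_filt_iff hr]
  exact liePlus_le_lie ((mem_filtPlus_iff hr.le).1 hg)

end

/-- The `O`-module `𝔤_{x,r} / 𝔤_{x,r+}`. -/
abbrev LieQuot (E : Type*) [Field E] [Algebra O E] (ϖ : O) (x : ι → ℝ) (r : ℝ) : Type _ :=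
  ↥(lie E ϖ x r) ⧸ (liePlus E ϖ x r).submoduleOf (lie E ϖ x r)

/-- The homomorphism `G_{x,r} → 𝔤_{x,r} / 𝔤_{x,r+}`, `1 + X ↦ X`, for `r > 0`. -/
def redHom (E : Type*) [Field E] [Algebra O E] (ϖ : O) [IsPseudoUniformizer E ϖ] (x : ι → ℝ)
    (r : Set.Ioi (0 : ℝ)) :
    ↥(filt E ϖ x r) →* Multiplicative (LieQuot E ϖ x r) where
  toFun g := Multiplicative.ofAdd (Submodule.Quotient.mk
    ⟨(g : GL ι E) - 1, (mem_filt_iff r.2).1 g.2⟩)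
  map_one' := by
    rw [← ofAdd_zero]
    congr 1
    rw [Submodule.Quotient.mk_eq_zero]
    simp [Submodule.submoduleOf]
  map_mul' g h := by
    rw [← ofAdd_add, ← Submodule.Quotient.mk_add]
    congr 1
    rw [Submodule.Quotient.eq, Submodule.submoduleOf, Submodule.mem_comap]
    have hr : (0 : ℝ) < r := r.2
    have e : ((lie E ϖ x r).subtype (⟨((g * h : ↥(filt E ϖ x r)) : GL ι E) - 1,
        (mem_filt_iff r.2).1 (g * h).2⟩ - (⟨(g : GL ι E) - 1, (mem_filt_iff r.2).1 g.2⟩ +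
        ⟨(h : GL ι E) - 1, (mem_filt_iff r.2).1 h.2⟩)) : Matrix ι ι E) =
        ((g : GL ι E) - 1) * ((h : GL ι E) - 1) := by
      simp
      noncomm_ring
    rw [e]
    exact lie_le_liePlus (s := r + r) (by linarith)
      (lie_mul le_rfl ((mem_filt_iff hr).1 g.2) ((mem_filt_iff hr).1 h.2))

section

variable (E ϖ)
variable [IsPseudoUniformizer E ϖ] (x : ι → ℝ) (r : Set.Ioi (0 : ℝ))

theorem redHom_ker :
    (redHom E ϖ x r).ker = (filtPlus E ϖ x r).subgroupOf (filt E ϖ x r) := by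
  ext g
  rw [MonoidHom.mem_ker, Subgroup.mem_subgroupOf, mem_filtPlus_iff (le_of_lt r.2)]
  change Multiplicative.ofAdd _ = Multiplicative.ofAdd 0 ↔ _
  rw [Multiplicative.ofAdd.injective.eq_iff, Submodule.Quotient.mk_eq_zero]
  rfl

theorem redHom_surjective : Function.Surjective (redHom E ϖ x r) := by
  intro y
  obtain ⟨X, hX⟩ := Submodule.Quotient.mk_surjective _ (Multiplicative.toAdd y)
  obtain ⟨g, hg, h⟩ := exists_filt r.2 X.2
  refine ⟨⟨g, hg⟩, ?_⟩
  change Multiplicative.ofAdd _ = Multiplicative.ofAdd (Multiplicative.toAdd y)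
  rw [← hX]
  congr 2
  exact Subtype.ext (by simp [h])

instance filtPlus_normal : ((filtPlus E ϖ x r).subgroupOf (filt E ϖ x r)).Normal :=
  redHom_ker E ϖ x r ▸ MonoidHom.normal_ker _

instance filtPlus_zero_normal : ((filtPlus E ϖ x 0).subgroupOf (filt E ϖ x 0)).Normal where
  conj_mem h hh g := by
    rw [Subgroup.mem_subgroupOf] at hh ⊢
    exact conj_mem_filtPlus le_rfl g.2 hh


end

/-- The residue ring `O / 𝔭`, with `𝔭 = ϖ O`. -/
abbrev ResRing (ϖ : O) : Type _ := O ⧸ Ideal.span {ϖ}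

/-- The reductive quotient `G_x = G_{x,0} / G_{x,0+}`. -/
abbrev RedQuot (E : Type*) [Field E] [Algebra O E] (ϖ : O) (x : ι → ℝ) : Type _ :=
  ↥(filt E ϖ x 0) ⧸ (filtPlus E ϖ x 0).subgroupOf (filt E ϖ x 0)

/-- The Moy--Prasad quotient `V_{x,r} = G_{x,r} / G_{x,r+}`, for `r > 0`, written additively. -/
def V (E : Type*) [Field E] [Algebra O E] (ϖ : O) (x : ι → ℝ) (r : Set.Ioi (0 : ℝ)) : Type _ :=
  Additive (↥(filt E ϖ x r) ⧸ (filtPlus E ϖ x r).subgroupOf (filt E ϖ x r))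

section

variable (E ϖ)
variable [IsPseudoUniformizer E ϖ] (x : ι → ℝ) (r : Set.Ioi (0 : ℝ))

instance : AddGroup (V E ϖ x r) :=
  inferInstanceAs (AddGroup
    (Additive (↥(filt E ϖ x r) ⧸ (filtPlus E ϖ x r).subgroupOf (filt E ϖ x r))))

/-- The quotient map `G_{x,r} → V_{x,r}`. -/
def V.mk : ↥(filt E ϖ x r) →* Multiplicative (V E ϖ x r) :=
  QuotientGroup.mk' ((filtPlus E ϖ x r).subgroupOf (filt E ϖ x r))

/-- The Moy--Prasad isomorphism `G_{x,r} / G_{x,r+} ≃ 𝔤_{x,r} / 𝔤_{x,r+}`, `1 + X ↦ X`. -/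
def vEquiv : V E ϖ x r ≃+ LieQuot E ϖ x r :=
  MulEquiv.toAdditiveLeft
    ((QuotientGroup.quotientMulEquivOfEq (redHom_ker E ϖ x r).symm).trans
      (QuotientGroup.quotientKerEquivOfSurjective _ (redHom_surjective E ϖ x r)))

theorem vEquiv_mk (g : ↥(filt E ϖ x r)) :
    vEquiv E ϖ x r (Multiplicative.toAdd (V.mk E ϖ x r g)) =
      Submodule.Quotient.mk ⟨(g : GL ι E) - 1, (mem_filt_iff r.2).1 g.2⟩ := rfl

theorem V.mk_surjective (v : V E ϖ x r) :
    ∃ g : ↥(filt E ϖ x r), Multiplicative.toAdd (V.mk E ϖ x r g) = v :=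
  QuotientGroup.mk'_surjective ((filtPlus E ϖ x r).subgroupOf (filt E ϖ x r)) v

instance : AddCommGroup (V E ϖ x r) where
  add_comm v w := (vEquiv E ϖ x r).injective (by rw [map_add, map_add, add_comm])

theorem lieQuot_isTorsionBy : Module.IsTorsionBy O (LieQuot E ϖ x r) ϖ := by
  intro y
  obtain ⟨X, rfl⟩ := Submodule.Quotient.mk_surjective _ y
  rw [← Submodule.Quotient.mk_smul, Submodule.Quotient.mk_eq_zero]
  exact smul_lie_le X.2

instance : Module (ResRing ϖ) (LieQuot E ϖ x r) := (lieQuot_isTorsionBy E ϖ x r).module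

/-- The structure of vector space over the residue field on `V_{x,r}`: scalars act through the
Moy--Prasad isomorphism, so that `c • [1 + X] = [1 + c X]`. -/
instance : Module (ResRing ϖ) (V E ϖ x r) := (vEquiv E ϖ x r).module (ResRing ϖ)

theorem vEquiv_smul (c : ResRing ϖ) (v : V E ϖ x r) :
    vEquiv E ϖ x r (c • v) = c • vEquiv E ϖ x r v :=
  (vEquiv E ϖ x r).apply_symm_apply _

theorem V.smul_mk (c : O) {g h : ↥(filt E ϖ x r)}
    (e : ((h : GL ι E) : Matrix ι ι E) - 1 = c • (((g : GL ι E) : Matrix ι ι E) - 1)) :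
    (Ideal.Quotient.mk (Ideal.span {ϖ}) c : ResRing ϖ) •
      (Multiplicative.toAdd (V.mk E ϖ x r g)) = Multiplicative.toAdd (V.mk E ϖ x r h) := by
  apply (vEquiv E ϖ x r).injective
  rw [vEquiv_smul, vEquiv_mk, vEquiv_mk]
  change c • (Submodule.Quotient.mk _ : LieQuot E ϖ x r) = _
  rw [← Submodule.Quotient.mk_smul]
  congr 1
  exact Subtype.ext e.symm

variable {E ϖ}

/-- Conjugation by an element of `G_{x,0}` on `G_{x,r}`. -/
def conjHom (g : ↥(filt E ϖ x 0)) : ↥(filt E ϖ x r) →* ↥(filt E ϖ x r) where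
  toFun h := ⟨g * h * (g : GL ι E)⁻¹, conj_mem_filt r.2 g.2 h.2⟩
  map_one' := Subtype.ext (by simp)
  map_mul' h h' := Subtype.ext (by simp [mul_assoc])

/-- The action of an element of `G_{x,0}` on `V_{x,r}` induced by conjugation. -/
def conjV (g : ↥(filt E ϖ x 0)) : V E ϖ x r →+ V E ϖ x r :=
  MonoidHom.toAdditive (QuotientGroup.map _ _ (conjHom x r g) (by
    intro h hh
    rw [Subgroup.mem_comap, Subgroup.mem_subgroupOf]
    exact conj_mem_filtPlus (le_of_lt r.2) g.2 hh))

theorem conjV_mk (g : ↥(filt E ϖ x 0)) (h : ↥(filt E ϖ x r)) :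
    conjV x r g (Multiplicative.toAdd (V.mk E ϖ x r h)) =
      Multiplicative.toAdd (V.mk E ϖ x r (conjHom x r g h)) := rfl

theorem conjV_smul (g : ↥(filt E ϖ x 0)) (c : ResRing ϖ) (v : V E ϖ x r) :
    conjV x r g (c • v) = c • conjV x r g v := by
  obtain ⟨c, rfl⟩ := Ideal.Quotient.mk_surjective c
  obtain ⟨h, rfl⟩ := V.mk_surjective E ϖ x r v
  obtain ⟨h', hh', e⟩ := exists_filt r.2
    (Submodule.smul_mem _ c ((mem_filt_iff r.2).1 h.2))
  have e' : (h' : Matrix ι ι E) - 1 = c • (((h : GL ι E) : Matrix ι ι E) - 1) := by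
    rw [e, add_sub_cancel_left]
  rw [V.smul_mk E ϖ x r c (g := h) (h := ⟨h', hh'⟩) e', conjV_mk, conjV_mk]
  refine (V.smul_mk E ϖ x r c ?_).symm
  change (↑((g : GL ι E) * h' * (g : GL ι E)⁻¹) : Matrix ι ι E) - 1 =
    c • ((↑((g : GL ι E) * h * (g : GL ι E)⁻¹) : Matrix ι ι E) - 1)
  rw [conj_sub_one, conj_sub_one, e', mul_smul_comm, smul_mul_assoc]

variable (E ϖ)

/-- The conjugation representation of `G_{x,0}` on `V_{x,r}`. -/
def filtRep : Representation (ResRing ϖ) ↥(filt E ϖ x 0) (V E ϖ x r) where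
  toFun g := { conjV x r g with map_smul' := conjV_smul x r g }
  map_one' := by
    ext v
    obtain ⟨h, rfl⟩ := V.mk_surjective E ϖ x r v
    change conjV x r 1 _ = _
    rw [conjV_mk]
    have e : conjHom x r 1 h = h := Subtype.ext (by simp [conjHom])
    rw [e]
    rfl
  map_mul' g g' := by
    ext v
    obtain ⟨h, rfl⟩ := V.mk_surjective E ϖ x r v
    change conjV x r (g * g') _ = conjV x r g (conjV x r g' _)
    rw [conjV_mk, conjV_mk, conjV_mk]
    have e : conjHom x r (g * g') h = conjHom x r g (conjHom x r g' h) :=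
      Subtype.ext (by simp [conjHom, mul_assoc])
    rw [e]

theorem filtRep_eq_one {g : ↥(filt E ϖ x 0)}
    (hg : g ∈ (filtPlus E ϖ x 0).subgroupOf (filt E ϖ x 0)) : filtRep E ϖ x r g = 1 := by
  ext v
  obtain ⟨h, rfl⟩ := V.mk_surjective E ϖ x r v
  change conjV x r g _ = _
  rw [conjV_mk]
  apply (vEquiv E ϖ x r).injective
  rw [Module.End.one_apply, vEquiv_mk, vEquiv_mk, Submodule.Quotient.eq]
  change (↑((g : GL ι E) * h * (g : GL ι E)⁻¹) : Matrix ι ι E) - 1 - (((h : GL ι E) :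
    Matrix ι ι E) - 1) ∈ liePlus E ϖ x r
  rw [Subgroup.mem_subgroupOf, mem_filtPlus_iff le_rfl] at hg
  have hh := (mem_filt_iff r.2).1 h.2
  obtain ⟨h1, h2⟩ := mem_lie_of_mem_filt_zero g.2
  have e : (↑((g : GL ι E) * h * (g : GL ι E)⁻¹) : Matrix ι ι E) - 1 - (((h : GL ι E) :
      Matrix ι ι E) - 1) =
      ((((g : GL ι E) : Matrix ι ι E) - 1) * (((h : GL ι E) : Matrix ι ι E) - 1) -
        (((h : GL ι E) : Matrix ι ι E) - 1) * (((g : GL ι E) : Matrix ι ι E) - 1)) *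
        (↑(g : GL ι E)⁻¹ : Matrix ι ι E) := by
    rw [conj_sub_one]
    have h3 : ((g : GL ι E) : Matrix ι ι E) * (↑(g : GL ι E)⁻¹ : Matrix ι ι E) = 1 :=
      Units.mul_inv _
    generalize (((h : GL ι E) : Matrix ι ι E) - 1) = A at *
    generalize (↑(g : GL ι E)⁻¹ : Matrix ι ι E) = B at *
    have h4 : A = A * ((g : GL ι E) : Matrix ι ι E) * B := by
      rw [mul_assoc, h3, mul_one]
    calc _ = ((g : GL ι E) : Matrix ι ι E) * A * B -
          A * ((g : GL ι E) : Matrix ι ι E) * B := by rw [← h4]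
      _ = _ := by noncomm_ring
  rw [e]
  refine liePlus_mul (r := r) (s := 0) (by simp) (Submodule.sub_mem _ ?_ ?_) h2
  · exact liePlus_mul (r := 0) (s := r) (by simp) hg hh
  · exact lie_mul_plus (r := r) (s := 0) (by simp) hh hg

/-- The representation `N` of the reductive quotient `G_x = G_{x,0} / G_{x,0+}` on `V_{x,r}` induced
by the conjugation action of `G_{x,0}` on `G_{x,r}`. -/
def moyPrasadRep : Representation (ResRing ϖ) (RedQuot E ϖ x) (V E ϖ x r) :=
  QuotientGroup.lift _ (filtRep E ϖ x r) fun _ hg => filtRep_eq_one E ϖ x r hg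

end

end Generic

noncomputable section Stability

/-- The algebra of polynomial functions on a module `W`: it is generated by the linear forms. -/
def polynomialFunctions (k W : Type*) [CommRing k] [AddCommGroup W] [Module k W] :
    Subalgebra k (W → k) :=
  Algebra.adjoin k (Set.range fun l : Module.Dual k W => (l : W → k))

/-- A subset of a finite-dimensional vector space is Zariski closed when it is the set of common
zeros of a set of polynomial functions. -/
def IsZariskiClosed (k : Type*) {W : Type*} [CommRing k] [AddCommGroup W] [Module k W]
    (Z : Set W) : Prop :=
  ∃ S : Set (W → k), S ⊆ polynomialFunctions k W ∧ Z = {w | ∀ f ∈ S, f w = 0}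

variable {k G W : Type*} [CommRing k] [Group G] [AddCommGroup W] [Module k W]

/-- The stabilizer in `G` of a functional, for the dual representation. -/
def functionalStabilizer (N : Representation k G W) (lam : Module.Dual k W) : Subgroup G where
  carrier := {g | N.dual g lam = lam}
  one_mem' := by
    change N.dual 1 lam = lam
    rw [map_one, Module.End.one_apply]
  mul_mem' {g h} hg hh := by
    change N.dual (g * h) lam = lam
    rw [map_mul, Module.End.mul_apply]
    exact (congrArg _ hh).trans hg
  inv_mem' {g} hg := by
    change N.dual g⁻¹ lam = lam
    conv_lhs => rw [← (hg : N.dual g lam = lam)]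
    rw [← Module.End.mul_apply, ← map_mul, inv_mul_cancel, map_one, Module.End.one_apply]

/-- A functional `lam` on a representation `N` of `G` is stable when its orbit under the dual
representation is Zariski closed in the dual space and its stabilizer is finite modulo `ker N`. -/
structure IsStable (N : Representation k G W) (lam : Module.Dual k W) : Prop where
  isZariskiClosed_orbit : IsZariskiClosed k (Set.range fun g : G => N.dual g lam)
  finite_stabilizer : Finite (↥(functionalStabilizer N lam) ⧸
    (MonoidHom.ker N).subgroupOf (functionalStabilizer N lam))

end Stability

noncomputable section Apartment

variable {n : ℕ}

/-- The affine roots of `GL_n`, as functions on the apartment `ℝ ^ n`: the functions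
`x ↦ x_i - x_j + m`, for `i ≠ j` and `m` an integer. -/
def affineRoots (n : ℕ) : Set ((Fin n → ℝ) → ℝ) :=
  {ψ | ∃ (i j : Fin n) (m : ℤ), i ≠ j ∧ ψ = fun x : Fin n → ℝ => x i - x j + m}

/-- The set of positive values at `x` of the affine roots; `r(x)` is its least element. -/
def positiveValues (x : Fin n → ℝ) : Set ℝ :=
  {s | 0 < s ∧ ∃ ψ ∈ affineRoots n, ψ x = s}

/-- The standard simple affine roots: `ψ_i = e_i - e_{i+1}` for all indices `i` but the last one,
and `1 - (e_1 - e_n)` for the last one. -/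
def simpleAffineRoot (i : Fin n) (x : Fin n → ℝ) : ℝ :=
  if h : (i : ℕ) + 1 < n then x i - x ⟨i + 1, h⟩ else 1 - (x ⟨0, i.pos⟩ - x i)

/-- The standard alcove `C`. -/
def alcove (n : ℕ) : Set (Fin n → ℝ) := {x | ∀ i, 0 < simpleAffineRoot i x}

/-- The facets of the closure of the standard alcove: the nonempty sets on which a given set `J` of
simple affine roots vanishes, the other simple affine roots being positive. -/
def IsFacet (𝓕 : Set (Fin n → ℝ)) : Prop :=
  𝓕.Nonempty ∧ ∃ J : Set (Fin n),
    𝓕 = {x | (∀ i ∈ J, simpleAffineRoot i x = 0) ∧ ∀ i ∉ J, 0 < simpleAffineRoot i x}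

/-- A proper facet is a facet of the closure of the alcove other than the alcove itself. -/
def IsProperFacet (𝓕 : Set (Fin n → ℝ)) : Prop := IsFacet 𝓕 ∧ 𝓕 ≠ alcove n

/-- A barycenter of a facet `𝓕`: a point of `𝓕` at which the simple affine roots that do not vanish
on `𝓕` all take the same value. (The simple affine roots are nonnegative on the closure of the
alcove and add up to `1`: modulo translation by the center they are the barycentric coordinates of
the simplex. So the common value is `1 / k`, for `k` nonvanishing simple affine roots, and a
barycenter is unique up to translation by the line spanned by `(1, …, 1)`.) -/
def IsBarycenter (𝓕 : Set (Fin n → ℝ)) (x : Fin n → ℝ) : Prop :=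
  x ∈ 𝓕 ∧ ∀ i j, simpleAffineRoot i x ≠ 0 → simpleAffineRoot j x ≠ 0 →
    simpleAffineRoot i x = simpleAffineRoot j x

end Apartment

noncomputable section LocalField

variable (F : Type*) [Field F] [ValuativeRel F] [TopologicalSpace F]
  [IsNonarchimedeanLocalField F]

/-- The maximal unramified extension of `F` in an algebraic closure: the compositum of all finite
unramified extensions, that is, of the finite extensions `K` whose ring of integers (the integral
closure of `𝒪[F]` in `K`) is unramified over `𝒪[F]`. -/
def maxUnramified : IntermediateField F (AlgebraicClosure F) :=
  sSup {K | FiniteDimensional F K ∧ Algebra.Unramified 𝒪[F] (integralClosure 𝒪[F] K)}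

/-- The field `F^un`. -/
abbrev FUn : Type _ := ↥(maxUnramified F)

/-- The ring of integers of `F^un`. -/
abbrev OUn : Type _ := ↥(integralClosure 𝒪[F] (FUn F))

variable {F}

/-- An element `ϖ` of the ring of integers of `F`, viewed in the ring of integers of `F^un`. A
uniformizer of `F` stays a uniformizer of `F^un`: the maximal ideal of `OUn F` is generated by `ϖ`,
and `ResRing (unif ϖ)` is the residue field of `F^un`, an algebraic closure of that of `F`. -/
abbrev unif (ϖ : 𝒪[F]) : OUn F := algebraMap 𝒪[F] (OUn F) ϖ

instance (ϖ : 𝒪[F]) [h : Fact (Irreducible ϖ)] : IsPseudoUniformizer (FUn F) (unif ϖ) where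
  map_ne_zero := by
    rw [← IsScalarTower.algebraMap_apply, IsScalarTower.algebraMap_apply 𝒪[F] F (FUn F)]
    simp [h.out.ne_zero]
  isUnit_one_add_mul c := by
    by_contra hc
    obtain ⟨M, hM, hc⟩ := exists_max_ideal_of_mem_nonunits hc
    have hm : (M.comap (algebraMap 𝒪[F] (OUn F))).IsMaximal :=
      Ideal.isMaximal_comap_of_isIntegral_of_isMaximal M
    have h1 : ϖ ∈ M.comap (algebraMap 𝒪[F] (OUn F)) := by
      rw [IsLocalRing.eq_maximalIdeal hm]
      exact h.out.not_isUnit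
    have h2 : (1 : OUn F) ∈ M := by
      simpa using M.sub_mem hc (M.mul_mem_right c (Ideal.mem_comap.1 h1))
    exact hM.ne_top ((Ideal.eq_top_iff_one M).2 h2)

end LocalField

end MoyPrasad

/-! ### Finite unramified domains over a complete discrete valuation ring -/

section FiniteUnramified

open IsLocalRing
universe u

/-! At a barycenter of a proper facet with `k` nonvanishing simple affine roots, `k < n`, the
differences of coordinates are multiples of `1 / k`, and `r(x) = 1 / k`. So `x` defines a
`ℤ/k`-grading of the standard basis in which every class occurs (`exists_grading_of_isBarycenter`).
Reducing matrices modulo the next filtration step embeds `V_x` as the matrices of degree `1` over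
the residue field and maps `G_x` onto the invertible matrices of degree `0`, acting by conjugation.
Through the trace form, a functional is a matrix `y` of degree `-1`.

Stability fails because the stabilizer is always too large. Since `k < n`, some nonscalar matrix `a`
of degree `0` commutes with `y` (`exists_commute_ne_scalar`): either `y ^ k` is such a matrix, or,
for the least `l + 1 > 0` such that `y ^ (l + 1)` is scalar, one takes `∑ y ^ i * E_qp * y ^ (l -
i)` with a suitable matrix unit. It commutes with `y` by telescoping, and it cannot be a nonzero
scalar because its rank is at most `l + 1 ≤ k < n`. The matrices `1 + t a` are invertible for all
but finitely many `t` and fix the functional, while elements of `ker N` reduce to scalars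
(`eq_scalar_of_commute_single`). Distinct `t` therefore give distinct classes modulo `ker N`,
infinitely many over an infinite field (`not_finite_stabilizer`).

It remains to know that `𝔬 / ϖ𝔬` is an infinite field. Every element of `𝔬` lies in a finite
unramified `𝒪[F]`-algebra, which is local with maximal ideal `(ϖ)`, so it is a unit or divisible by
`ϖ` (`isUnit_or_dvd`). Roots of unity of arbitrarily large order prime to the residue characteristic
lie in `F^un` and keep their order in the residue field (`infinite_resRing`). -/

theorem isAdicComplete_of_finite {A M : Type u} [CommRing A] [IsNoetherianRing A] (I : Ideal A)
    [IsAdicComplete I A] [AddCommGroup M] [Module A M] [Module.Finite A M] :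
    IsAdicComplete I M := by
  rw [← AdicCompletion.of_bijective_iff]
  have h1 : Function.Bijective (AdicCompletion.of I A) := AdicCompletion.of_bijective_iff.2 inferInstance
  have h2 := AdicCompletion.ofTensorProduct_bijective_of_finite_of_isNoetherian I M
  -- The completion of `M` is `Â ⊗ M`, and `Â = A`, so `M` is its own completion.
  let e := LinearEquiv.ofBijective _ h1
  have h3 := h2.comp ((TensorProduct.lid A M).symm.trans (TensorProduct.congr e (.refl A M))).bijective
  convert h3
  ext m n
  simp [e]
  exact (one_smul A _).symm

/-- The chain of powers of `x` stops, so `x ^ n = x ^ (n + 1) * y` and `x ^ n * y ^ n` is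
idempotent. If it is `0`, then `x` is nilpotent, hence zero; if it is `1`, then `x` is invertible.
-/
theorem isField_of_isReduced_of_isArtinianRing {R : Type*} [CommRing R] [Nontrivial R]
    [IsReduced R] [IsArtinianRing R] (h : ∀ e : R, e * e = e → e = 0 ∨ e = 1) : IsField R := by
  refine ⟨exists_pair_ne R, mul_comm, fun {x} hx => ?_⟩
  obtain ⟨n, y, hy⟩ := IsArtinian.exists_pow_succ_smul_dvd x (1 : R)
  simp only [smul_eq_mul, mul_one, pow_succ] at hy
  have h2 : ∀ m : ℕ, x ^ n = x ^ n * (x * y) ^ m := by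
    intro m
    induction m with
    | zero => simp
    | succ m ih =>
      calc x ^ n = x ^ n * (x * y) ^ m := ih
        _ = (x ^ n * x * y) * (x * y) ^ m := by rw [hy]
        _ = _ := by ring
  have h3 : x ^ n = x ^ n * (x ^ n * y ^ n) := by
    conv_lhs => rw [h2 n, mul_pow]
  rcases h (x ^ n * y ^ n) (by
    calc x ^ n * y ^ n * (x ^ n * y ^ n) = (x ^ n * (x ^ n * y ^ n)) * y ^ n := by ring
      _ = _ := by rw [← h3]) with h4 | h4
  · rw [h4, mul_zero] at h3
    exact absurd (IsNilpotent.eq_zero ⟨n, h3⟩) hx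
  · cases n with
    | zero => exact ⟨y, by simpa using hy⟩
    | succ n => exact ⟨x ^ n * y ^ (n + 1), by rw [← h4]; ring⟩

section
variable {A : Type u} [CommRing A] [IsDomain A] [IsDiscreteValuationRing A]
    [IsAdicComplete (maximalIdeal A) A]

/-- Unramifiedness makes the fibre `C ⧸ I` reduced, and it is finite over the residue field.
Idempotents of the fibre lift to the domain `C`, by completeness, so they are trivial and the fibre
is a field. Completeness also puts `I` in every maximal ideal, so `I` is the only one. -/
theorem isMaximal_map_maximalIdeal (C : Type u) [CommRing C] [IsDomain C] [Algebra A C]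
    [Module.Finite A C] [Algebra.FormallyUnramified A C] :
    ((maximalIdeal A).map (algebraMap A C)).IsMaximal ∧
    (maximalIdeal A).map (algebraMap A C) ≤ Ideal.jacobson ⊥  := by
  have := isAdicComplete_of_finite (M := C) (maximalIdeal A)
  set I := (maximalIdeal A).map (algebraMap A C) with hI
  have hc : IsAdicComplete I C := (IsAdicComplete.map_algebraMap_iff _ C).2 this
  have hj := IsAdicComplete.le_jacobson_bot (R := C) I
  have hr : I.IsRadical := Algebra.FormallyUnramified.isRadical_map_isMaximal _ C (maximalIdeal A)
  rw [Ideal.isRadical_iff_quotient_reduced] at hr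
  let : Field (A ⧸ maximalIdeal A) := Ideal.Quotient.field _
  have : IsArtinianRing (C ⧸ I) :=
    IsArtinianRing.of_finite (A ⧸ maximalIdeal A) (C ⧸ I)
  have : Nontrivial (C ⧸ I) := Ideal.Quotient.nontrivial_iff.2 (by
    rintro h
    rw [h, top_le_iff, Ideal.jacobson_eq_top_iff] at hj
    exact bot_ne_top hj)
  refine ⟨Ideal.Quotient.maximal_of_isField _ (isField_of_isReduced_of_isArtinianRing ?_), hj⟩
  intro e he
  obtain ⟨a, rfl⟩ := Ideal.Quotient.mk_surjective e
  have he' : (Ideal.Quotient.mk I) (a * a - a) = 0 := by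
    rw [map_sub, map_mul, he, sub_self]
  -- The derivative `2a - 1` is its own inverse modulo `I`, because `(2a - 1)² = 4(a² - a) + 1`; so
  -- Hensel's lemma applies even in residue characteristic `2`.
  obtain ⟨b, hb, hab⟩ := HenselianRing.is_henselian (I := I) (Polynomial.X ^ 2 - Polynomial.X : Polynomial C)
    (by monicity!) a (by
      rw [Ideal.Quotient.eq_zero_iff_mem] at he'
      simpa [pow_two] using he') (by
      refine IsUnit.of_mul_eq_one (Ideal.Quotient.mk I (2 * a - 1)) ?_
      have : (2 * a - 1) * (2 * a - 1) = 4 * (a * a - a) + 1 := by ring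
      simp only [Polynomial.derivative_sub, Polynomial.derivative_X_pow, Polynomial.derivative_X]
      simp only [Polynomial.eval_sub, Polynomial.eval_mul]
      simp
      have h := congrArg (Ideal.Quotient.mk I) this
      rw [map_add, map_mul _ 4, he'] at h
      simpa using h)
  have hb' : b * (b - 1) = 0 := by
    have : Polynomial.eval b (Polynomial.X ^ 2 - Polynomial.X : Polynomial C) = 0 := hb
    simp at this
    linear_combination this
  have : Ideal.Quotient.mk I a = Ideal.Quotient.mk I b := by
    rw [eq_comm, Ideal.Quotient.eq]; exact hab
  rw [this]
  rcases mul_eq_zero.1 hb' with h | h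
  · left; simp [h]
  · right; simp [sub_eq_zero.1 h]

theorem isUnit_of_not_dvd (C : Type u) [CommRing C] [IsDomain C] [Algebra A C]
    [Module.Finite A C] [Algebra.FormallyUnramified A C] {ϖ : A} (hϖ : Irreducible ϖ)
    {c : C} (hc : ¬ algebraMap A C ϖ ∣ c) : IsUnit c := by
  obtain ⟨h1, h2⟩ := isMaximal_map_maximalIdeal (A := A) C
  rw [hϖ.maximalIdeal_eq, Ideal.map_span, Set.image_singleton] at h1 h2
  by_contra hu
  obtain ⟨M, hM, hcM⟩ := exists_max_ideal_of_mem_nonunits hu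
  have h3 : Ideal.span {algebraMap A C ϖ} ≤ M := by
    refine h2.trans ?_
    exact sInf_le ⟨bot_le, hM⟩
  have := h1.eq_of_le hM.ne_top h3
  exact hc (Ideal.mem_span_singleton.1 (this ▸ hcM))

/-- `C` is a Noetherian local domain with principal maximal ideal, generated by a uniformizer of
`A`. -/
theorem isIntegrallyClosed_of_formallyUnramified (C : Type u) [CommRing C] [IsDomain C] [Algebra A C]
    [Module.Finite A C] [Algebra.FormallyUnramified A C] : IsIntegrallyClosed C := by
  obtain ⟨ϖ, hϖ⟩ := IsDiscreteValuationRing.exists_irreducible A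
  have key := fun c => isUnit_of_not_dvd C hϖ (c := c)
  obtain ⟨h1, h2⟩ := isMaximal_map_maximalIdeal (A := A) C
  rw [hϖ.maximalIdeal_eq, Ideal.map_span, Set.image_singleton] at h1 h2
  have hloc : IsLocalRing C := .of_unique_max_ideal ⟨_, h1, fun M hM => by
    symm
    refine h1.eq_of_le hM.ne_top (h2.trans (sInf_le ⟨bot_le, hM⟩))⟩
  have : IsNoetherianRing C := IsNoetherianRing.of_finite A C
  have hp : (maximalIdeal C).IsPrincipal := ⟨_, (IsLocalRing.eq_maximalIdeal h1).symm⟩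
  have := ((tfae_of_isNoetherianRing_of_isLocalRing_of_isDomain C).out 4 3).1 hp
  exact this.1
end

end FiniteUnramified

/-! ### Finite unramified subalgebras and the maximal unramified extension -/

section UnramifiedSubalgebras

open IsLocalRing TensorProduct
universe u

variable {A F Ω : Type u} [CommRing A] [IsDomain A] [Field F] [Algebra A F] [IsFractionRing A F]
    [Field Ω] [Algebra F Ω] [Algebra A Ω] [IsScalarTower A F Ω]

/-- A finite, formally unramified subalgebra. -/
def IsFiniteUnramified (C : Subalgebra A Ω) : Prop :=
  Module.Finite A C ∧ Algebra.FormallyUnramified A C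

theorem IsFiniteUnramified.of_surjective {B : Type u} [CommRing B] [Algebra A B]
    [Module.Finite A B] [Algebra.FormallyUnramified A B] {C : Subalgebra A Ω} (f : B →ₐ[A] Ω)
    (hf : f.range = C) : IsFiniteUnramified C := by
  subst hf
  exact ⟨Module.Finite.of_surjective f.rangeRestrict.toLinearMap f.rangeRestrict_surjective,
    .of_surjective f.rangeRestrict f.rangeRestrict_surjective⟩

/-- `C ⊔ D` is a quotient of `C ⊗ D`, which is unramified over `C` by base change, hence over `A`.
-/
theorem IsFiniteUnramified.sup {C D : Subalgebra A Ω} (hC : IsFiniteUnramified C)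
    (hD : IsFiniteUnramified D) : IsFiniteUnramified (C ⊔ D) := by
  have := hC.1; have := hC.2; have := hD.1; have := hD.2
  have : Algebra.FormallyUnramified A (C ⊗[A] D) := .comp A C (C ⊗[A] D)
  exact .of_surjective (Algebra.TensorProduct.productMap C.val D.val)
    (by rw [Algebra.TensorProduct.productMap_range, Subalgebra.range_val, Subalgebra.range_val])

variable (F) in
/-- The field of fractions of a subalgebra, as an intermediate field. -/
def fracField (C : Subalgebra A Ω) : IntermediateField F Ω where
  carrier := {z | ∃ a ∈ C, ∃ b ∈ C, b ≠ 0 ∧ z = a / b}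
  mul_mem' := by
    rintro _ _ ⟨a, ha, b, hb, hb0, rfl⟩ ⟨c, hc, d, hd, hd0, rfl⟩
    exact ⟨a * c, mul_mem ha hc, b * d, mul_mem hb hd, mul_ne_zero hb0 hd0, by field_simp⟩
  add_mem' := by
    rintro _ _ ⟨a, ha, b, hb, hb0, rfl⟩ ⟨c, hc, d, hd, hd0, rfl⟩
    exact ⟨a * d + c * b, add_mem (mul_mem ha hd) (mul_mem hc hb), b * d, mul_mem hb hd,
      mul_ne_zero hb0 hd0, by field_simp⟩
  algebraMap_mem' z := by
    obtain ⟨a, b, hb, rfl⟩ := IsFractionRing.div_surjective (A := A) z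
    refine ⟨algebraMap A Ω a, C.algebraMap_mem a, algebraMap A Ω b, C.algebraMap_mem b, ?_, ?_⟩
    · rw [IsScalarTower.algebraMap_apply A F Ω]
      simpa using nonZeroDivisors.ne_zero hb
    · simp [← IsScalarTower.algebraMap_apply]
  inv_mem' := by
    rintro _ ⟨a, ha, b, hb, hb0, rfl⟩
    by_cases h : a = 0
    · exact ⟨0, C.zero_mem, 1, C.one_mem, one_ne_zero, by simp [h]⟩
    · exact ⟨b, hb, a, ha, h, by simp⟩

theorem subset_fracField {C : Subalgebra A Ω} {z : Ω} (hz : z ∈ C) : z ∈ fracField F C :=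
  ⟨z, hz, 1, C.one_mem, one_ne_zero, by simp⟩

theorem fracField_mono {C D : Subalgebra A Ω} (h : C ≤ D) : fracField F C ≤ fracField F D := by
  rintro _ ⟨a, ha, b, hb, hb0, rfl⟩
  exact ⟨a, h ha, b, h hb, hb0, rfl⟩

theorem exists_le_fracField [CharZero F] [IsDiscreteValuationRing A]
    (K : IntermediateField F Ω) [FiniteDimensional F K]
    (h : Algebra.FormallyUnramified A (integralClosure A K)) :
    ∃ C : Subalgebra A Ω, IsFiniteUnramified C ∧ K ≤ fracField F C := by
  -- Characteristic zero makes `K / F` separable, so the integral closure is a finite module.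
  have : Module.Finite A (integralClosure A K) := IsIntegralClosure.finite A F K _
  let f : integralClosure A K →ₐ[A] Ω := (K.val.restrictScalars A).comp (integralClosure A K).val
  refine ⟨f.range, .of_surjective f rfl, fun z hz => ?_⟩
  have : Algebra.IsAlgebraic A K := by
    have := Algebra.IsAlgebraic.of_finite F K
    exact (IsFractionRing.comap_isAlgebraic_iff (A := A) (K := F) (C := K)).2 this
  obtain ⟨y, hy0, hy⟩ := (Algebra.IsAlgebraic.isAlgebraic (R := A) (⟨z, hz⟩ : K)).exists_integral_multiple
  have hy' : algebraMap A Ω y ≠ 0 := by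
    rw [IsScalarTower.algebraMap_apply A F Ω]
    simpa using hy0
  refine ⟨_, ⟨⟨_, hy⟩, rfl⟩, algebraMap A Ω y, Subalgebra.algebraMap_mem _ y, hy', ?_⟩
  rw [eq_div_iff hy']
  simp [f, Algebra.smul_def, mul_comm]
  exact Or.inl rfl

section
variable [IsDiscreteValuationRing A] [IsAdicComplete (maximalIdeal A) A]

theorem mem_of_isIntegral {C : Subalgebra A Ω} (hC : IsFiniteUnramified C) {z : Ω}
    (hz : z ∈ fracField F C) (hi : IsIntegral A z) : z ∈ C := by
  have := hC.1; have := hC.2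
  have : IsIntegrallyClosed C := isIntegrallyClosed_of_formallyUnramified (A := A) C
  obtain ⟨a, ha, b, hb, hb0, rfl⟩ := hz
  let f : FractionRing C →ₐ[C] Ω := IsFractionRing.liftAlgHom (g := Algebra.ofId C Ω)
    (FaithfulSMul.algebraMap_injective C Ω)
  let w : FractionRing C := algebraMap C _ ⟨a, ha⟩ / algebraMap C _ ⟨b, hb⟩
  have hw : f w = a / b := by
    simp only [w, map_div₀, AlgHom.commutes]
    rfl
  rw [← hw] at hi ⊢
  have h2 : IsIntegral C w := (isIntegral_algHom_iff f f.injective).1 (hi.tower_top)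
  obtain ⟨y, hy⟩ := IsIntegrallyClosed.isIntegral_iff.1 h2
  rw [← hy, AlgHom.commutes]
  exact y.2

/-- The compositum is contained in the union of the fraction fields of finite unramified
subalgebras, a directed union by `IsFiniteUnramified.sup`. An integral element of one such fraction
field lies in the subalgebra itself, which is integrally closed. -/
theorem exists_isFiniteUnramified_of_mem_sSup [CharZero F] {z : Ω}
    (hz : z ∈ (sSup {K | FiniteDimensional F K ∧ Algebra.Unramified A (integralClosure A K)} :
      IntermediateField F Ω)) (hi : IsIntegral A z) :
    ∃ C : Subalgebra A Ω, IsFiniteUnramified C ∧ z ∈ C := by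
  have h1 : (sSup {K | FiniteDimensional F K ∧ Algebra.Unramified A (integralClosure A K)} :
      IntermediateField F Ω) ≤ ⨆ C : {C : Subalgebra A Ω // IsFiniteUnramified C},
        fracField F C.1 := by
    refine sSup_le fun K ⟨hK, hU⟩ => ?_
    obtain ⟨C, hC, hKC⟩ := exists_le_fracField (A := A) K hU.1
    exact hKC.trans (le_iSup (fun C : {C : Subalgebra A Ω // IsFiniteUnramified C} =>
        fracField F C.1) ⟨C, hC⟩)
  have hd : Directed (· ≤ ·) fun C : {C : Subalgebra A Ω // IsFiniteUnramified C} =>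
      fracField F C.1 := fun C D => ⟨⟨C.1 ⊔ D.1, C.2.sup D.2⟩, fracField_mono le_sup_left,
        fracField_mono le_sup_right⟩
  have : Nonempty {C : Subalgebra A Ω // IsFiniteUnramified C} :=
    ⟨⊥, .of_surjective (Algebra.ofId A Ω) (by ext; simp [Algebra.mem_bot])⟩
  have h2 := h1 hz
  rw [← SetLike.mem_coe, IntermediateField.coe_iSup_of_directed hd, Set.mem_iUnion] at h2
  obtain ⟨C, hC⟩ := h2
  exact ⟨C.1, C.2, mem_of_isIntegral C.2 hC hi⟩

/-- Since `C` is integrally closed, it maps onto the integral closure of `A` in `K`, and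
unramifiedness passes to quotients. -/
theorem unramified_integralClosure {C : Subalgebra A Ω} (hC : IsFiniteUnramified C)
    {K : IntermediateField F Ω} (hCK : ∀ z ∈ C, z ∈ K) (hKC : K ≤ fracField F C) :
    Algebra.Unramified A (integralClosure A K) := by
  have := hC.1; have := hC.2
  let g : C →ₐ[A] K :=
    { toFun := fun z => ⟨z, hCK z z.2⟩
      map_one' := rfl
      map_mul' := fun _ _ => rfl
      map_zero' := rfl
      map_add' := fun _ _ => rfl
      commutes' := fun _ => rfl }
  let f : C →ₐ[A] integralClosure A K :=
    g.codRestrict _ fun z => (Algebra.IsIntegral.isIntegral (R := A) z).map g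
  have hf : Function.Surjective f := by
    intro z
    have h := z.2
    refine ⟨⟨z.1.1, mem_of_isIntegral hC (hKC z.1.2) ?_⟩, rfl⟩
    exact (isIntegral_algHom_iff (K.val.restrictScalars A) (by exact Subtype.val_injective)).2 h
  exact ⟨.of_surjective f hf, .of_surjective f hf⟩

/-- Differentiating `ζ ^ m = 1` gives `m ζ ^ (m - 1) dζ = 0` with a unit coefficient, so `dζ = 0`
and all Kähler differentials vanish. -/
theorem isFiniteUnramified_adjoin {ζ : Ω} {m : ℕ} (hm : IsUnit (m : A)) (hm0 : m ≠ 0)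
    (hζ : ζ ^ m = 1) : IsFiniteUnramified (Algebra.adjoin A {ζ}) := by
  have hint : IsIntegral A ζ := .of_pow (Nat.pos_of_ne_zero hm0) (hζ ▸ isIntegral_one)
  refine ⟨Algebra.finite_adjoin_simple_of_isIntegral hint, ⟨?_⟩⟩
  let C := Algebra.adjoin A {ζ}
  have hD : (KaehlerDifferential.D A C : Derivation A C _) = 0 := by
    refine Derivation.ext_of_adjoin_eq_top _ (Algebra.adjoin_adjoin_coe_preimage (s := {ζ})) ?_
    intro z hz
    have hz' : (z : Ω) = ζ := hz
    have h1 : z ^ m = 1 := Subtype.ext (by simp [hz', hζ])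
    have h2 := congrArg (KaehlerDifferential.D A C) h1
    rw [Derivation.leibniz_pow, Derivation.map_one_eq_zero] at h2
    have hu : IsUnit ((m : C) * z ^ (m - 1)) := by
      refine IsUnit.mul (by simpa using hm.map (algebraMap A C)) ?_
      refine IsUnit.pow _ (IsUnit.of_pow_eq_one h1 hm0)
    rw [Derivation.zero_apply]
    rw [← hu.smul_eq_zero, mul_smul, Nat.cast_smul_eq_nsmul]
    exact h2
  have hle : (⊤ : Submodule C (Ω[C⁄A])) ≤ ⊥ := by
    rw [← KaehlerDifferential.span_range_derivation, Submodule.span_le]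
    rintro _ ⟨x, rfl⟩
    simp [hD]
  exact (subsingleton_iff_forall_eq 0).2 fun y => hle trivial

theorem mem_sSup_of_pow_eq_one {ζ : Ω} {m : ℕ} (hm : IsUnit (m : A)) (hm0 : m ≠ 0)
    (hζ : ζ ^ m = 1) : ζ ∈ (sSup {K | FiniteDimensional F K ∧
      Algebra.Unramified A (integralClosure A K)} : IntermediateField F Ω) := by
  have hint : IsIntegral F ζ := .of_pow (Nat.pos_of_ne_zero hm0) (hζ ▸ isIntegral_one)
  have hC := isFiniteUnramified_adjoin (A := A) hm hm0 hζ
  have hmem : ζ ∈ Algebra.adjoin A {ζ} := Algebra.self_mem_adjoin_singleton A ζ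
  have hle : IntermediateField.adjoin F {ζ} ≤ fracField F (Algebra.adjoin A {ζ}) := by
    rw [IntermediateField.adjoin_simple_le_iff]
    exact subset_fracField hmem
  have h : IntermediateField.adjoin F {ζ} ∈ {K : IntermediateField F Ω | FiniteDimensional F K ∧
      Algebra.Unramified A (integralClosure A K)} := by
    refine ⟨IntermediateField.adjoin.finiteDimensional hint, unramified_integralClosure hC ?_ hle⟩
    intro z hz
    have : Algebra.adjoin A {ζ} ≤
        (IntermediateField.adjoin F {ζ}).toSubalgebra.restrictScalars A := by
      rw [Algebra.adjoin_le_iff, Set.singleton_subset_iff]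
      exact IntermediateField.mem_adjoin_simple_self F ζ
    exact this hz
  exact le_sSup h (IntermediateField.mem_adjoin_simple_self F ζ)

end

end UnramifiedSubalgebras

/-! ### The residue ring of the maximal unramified extension is an infinite field -/

section ResidueField

open IsLocalRing TensorProduct

namespace MoyPrasad
section
variable {F : Type*} [Field F] [CharZero F] [ValuativeRel F] [TopologicalSpace F]
  [IsNonarchimedeanLocalField F]

variable (F) in
theorem isAdicComplete_integer : IsAdicComplete (maximalIdeal 𝒪[F]) 𝒪[F] :=
  let := IsTopologicalAddGroup.rightUniformSpace F
  have := isUniformAddGroup_of_addCommGroup (G := F)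
  inferInstance

/-- The dichotomy holds in `C`. The inverse, or the quotient by `ϖ`, found in `C` is integral and
already lies in the field `F^un`, so it belongs to its ring of integers. -/
theorem dvd_of_isFiniteUnramified {C : Subalgebra 𝒪[F] (AlgebraicClosure F)}
    (hC : IsFiniteUnramified C) {ϖ : 𝒪[F]} (hϖ : Irreducible ϖ) {z : OUn F}
    (hz : ((z : FUn F) : AlgebraicClosure F) ∈ C) : IsUnit z ∨ unif ϖ ∣ z := by
  have := isAdicComplete_integer F
  have := hC.1; have := hC.2
  have hCi : ∀ w : FUn F, (w : AlgebraicClosure F) ∈ C → w ∈ integralClosure 𝒪[F] (FUn F) := by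
    intro w hw
    have h1 : IsIntegral 𝒪[F] (⟨w, hw⟩ : C) := Algebra.IsIntegral.isIntegral _
    have h2 := h1.map C.val
    exact (isIntegral_algHom_iff ((maxUnramified F).val.restrictScalars 𝒪[F])
      (by exact Subtype.val_injective)).1 h2
  by_cases h : algebraMap 𝒪[F] C ϖ ∣ ⟨_, hz⟩
  · right
    obtain ⟨c, hc⟩ := h
    have hc' : ((z : FUn F) : AlgebraicClosure F) = algebraMap 𝒪[F] _ ϖ * c := congrArg Subtype.val hc
    have h0 : algebraMap 𝒪[F] (FUn F) ϖ ≠ 0 := by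
      rw [IsScalarTower.algebraMap_apply 𝒪[F] F (FUn F)]
      simp [hϖ.ne_zero]
    have h0' : algebraMap 𝒪[F] (AlgebraicClosure F) ϖ ≠ 0 := by
      rw [IsScalarTower.algebraMap_apply 𝒪[F] F (AlgebraicClosure F)]
      simp [hϖ.ne_zero]
    have h1 : (((z : FUn F) / algebraMap 𝒪[F] (FUn F) ϖ : FUn F) : AlgebraicClosure F) = c := by
      have : ((algebraMap 𝒪[F] (FUn F) ϖ : FUn F) : AlgebraicClosure F) = algebraMap 𝒪[F] _ ϖ := rfl
      push_cast
      rw [this, div_eq_iff h0', hc', mul_comm]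
    refine ⟨⟨(z : FUn F) / algebraMap 𝒪[F] (FUn F) ϖ, hCi _ (h1 ▸ c.2)⟩, Subtype.ext ?_⟩
    change (z : FUn F) = algebraMap 𝒪[F] (FUn F) ϖ * _
    field_simp
  · left
    obtain ⟨u, hu⟩ := (isUnit_of_not_dvd C hϖ h).exists_right_inv
    have hu' : ((z : FUn F) : AlgebraicClosure F) * u = 1 := congrArg Subtype.val hu
    have h1 : (((z : FUn F)⁻¹ : FUn F) : AlgebraicClosure F) = u := by
      push_cast
      exact inv_eq_of_mul_eq_one_right hu'
    refine IsUnit.of_mul_eq_one ⟨(z : FUn F)⁻¹, hCi _ (h1 ▸ u.2)⟩ (Subtype.ext ?_)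
    change (z : FUn F) * (z : FUn F)⁻¹ = 1
    refine mul_inv_cancel₀ fun h0 => ?_
    rw [h0] at hu'
    simp at hu'

theorem isUnit_or_dvd {ϖ : 𝒪[F]} (hϖ : Irreducible ϖ) (z : OUn F) : IsUnit z ∨ unif ϖ ∣ z := by
  have := isAdicComplete_integer F
  have hi : IsIntegral 𝒪[F] ((z : FUn F) : AlgebraicClosure F) :=
    IsIntegral.map ((maxUnramified F).val.restrictScalars 𝒪[F]) z.2
  obtain ⟨C, hC, hz⟩ := exists_isFiniteUnramified_of_mem_sSup (F := F) z.1.2 hi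
  exact dvd_of_isFiniteUnramified hC hϖ hz

theorem not_isUnit_unif {ϖ : 𝒪[F]} (hϖ : Irreducible ϖ) : ¬ IsUnit (unif ϖ) := by
  have : Fact (Irreducible ϖ) := ⟨hϖ⟩
  intro h
  obtain ⟨u, hu⟩ := h.exists_right_inv
  have := IsPseudoUniformizer.isUnit_one_add_mul (FUn F) (ϖ := unif ϖ) (-u)
  simp [hu] at this

theorem isField_resRing {ϖ : 𝒪[F]} (hϖ : Irreducible ϖ) : IsField (ResRing (unif ϖ)) := by
  have : Nontrivial (ResRing (unif ϖ)) := Ideal.Quotient.nontrivial_iff.2 (by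
    rw [Ne, Ideal.span_singleton_eq_top]; exact not_isUnit_unif hϖ)
  refine ⟨exists_pair_ne _, mul_comm, fun {a} ha => ?_⟩
  obtain ⟨z, rfl⟩ := Ideal.Quotient.mk_surjective a
  rcases isUnit_or_dvd hϖ z with h | h
  · exact (h.map (Ideal.Quotient.mk _)).exists_right_inv
  · exact absurd (Ideal.Quotient.eq_zero_iff_mem.2 (Ideal.mem_span_singleton.2 h)) ha

theorem infinite_resRing {ϖ : 𝒪[F]} (hϖ : Irreducible ϖ) : Infinite (ResRing (unif ϖ)) := by
  have hac := isAdicComplete_integer F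
  let := (isField_resRing hϖ).toField
  refine ⟨fun hfin => ?_⟩
  obtain ⟨p, hp⟩ := CharP.exists (𝓀[F])
  have hp0 : p ≠ 0 := by
    rw [CharP.eq 𝓀[F] hp (ringChar.charP 𝓀[F])]
    exact CharP.ringChar_ne_zero_of_finite 𝓀[F]
  set N := Nat.card (ResRing (unif ϖ))
  -- This `m` exceeds the supposed cardinality `N` and is `1` modulo the residue characteristic `p`,
  -- hence a unit of `𝒪[F]`.
  set m := p * N + 1 with hm
  have hmu : IsUnit (m : 𝒪[F]) := by
    by_contra h
    rw [← mem_nonunits_iff, ← IsLocalRing.mem_maximalIdeal, ← IsLocalRing.residue_eq_zero_iff] at h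
    simp [hm] at h
  have hm0 : m ≠ 0 := by omega
  have : NeZero m := ⟨hm0⟩
  obtain ⟨ζ, hζ⟩ := HasEnoughRootsOfUnity.exists_primitiveRoot (AlgebraicClosure F) m
  have hζm : ζ ∈ maxUnramified F := mem_sSup_of_pow_eq_one hmu hm0 hζ.pow_eq_one
  let z : OUn F := ⟨⟨ζ, hζm⟩, (isIntegral_algHom_iff ((maxUnramified F).val.restrictScalars 𝒪[F])
      (by exact Subtype.val_injective)).1
      (.of_pow (Nat.pos_of_ne_zero hm0) (by change IsIntegral _ (ζ ^ m); rw [hζ.pow_eq_one]; exact isIntegral_one))⟩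
  have hzn : ∀ l : ℕ, z ^ l = 1 ↔ m ∣ l := by
    intro l
    rw [← hζ.pow_eq_one_iff_dvd, ← Subtype.coe_inj, ← Subtype.coe_inj]
    rfl
  let φ : OUn F →+* ResRing (unif ϖ) := Ideal.Quotient.mk (Ideal.span {unif ϖ})
  have hmR : (m : ResRing (unif ϖ)) ≠ 0 := by
    have h := hmu.map (φ.comp (algebraMap 𝒪[F] (OUn F)))
    rw [map_natCast] at h
    exact h.ne_zero
  have hz : IsPrimitiveRoot (φ z) m := by
    refine ⟨by rw [← map_pow, (hzn m).2 dvd_rfl, map_one], fun l hl => ?_⟩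
    rw [← hzn]
    by_contra hne
    -- If `z ^ l ≠ 1`, the geometric sum vanishes in the domain; but `z ^ l` reduces to `1`, so the
    -- sum reduces to `m`, which is nonzero in the residue field. Hence reduction preserves the
    -- order of `z`.
    have h1 : (z ^ l - 1) * ∑ i ∈ Finset.range m, (z ^ l) ^ i = 0 := by
      rw [mul_geom_sum, ← pow_mul, mul_comm l, pow_mul, (hzn m).2 dvd_rfl, one_pow, sub_self]
    have h2 := (mul_eq_zero.1 h1).resolve_left (sub_ne_zero.2 hne)
    have h3 := congrArg φ h2
    rw [map_sum, map_zero, Finset.sum_congr rfl (g := fun _ => 1)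
      fun i _ => by rw [map_pow, map_pow, hl, one_pow], Finset.sum_const, Finset.card_range,
      nsmul_one] at h3
    exact hmR h3
  have hcard : m ≤ N := by
    have hinj : Function.Injective fun i : Fin m => (φ z) ^ (i : ℕ) := fun i j h =>
      Fin.ext (hz.pow_inj i.2 j.2 h)
    have h := Nat.card_le_card_of_injective _ hinj
    rwa [Nat.card_eq_fintype_card, Fintype.card_fin] at h
  have : N ≤ p * N := Nat.le_mul_of_pos_left _ (Nat.pos_of_ne_zero hp0)
  omega

end
end MoyPrasad

end ResidueField

/-! ### Matrices graded by `ℤ/k` and their centralizers -/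

section GradedMatrices

open Matrix

variable {K ι : Type*} [Field K] [Fintype ι] [DecidableEq ι]

/-- Gaussian elimination inside each block: the finset `s` contains the labels of the blocks that
may still differ from the identity, and the induction splits off one block at a time. -/
theorem mem_of_blockDiagonal {K α : Type*} [inst : CommRing K] (hK : IsField K) [DecidableEq α]
    (d : ι → α) (S : Submonoid (Matrix ι ι K))
    (htr : ∀ i j c, i ≠ j → d i = d j → transvection i j c ∈ S)
    (hdiag : ∀ D : ι → K, (∀ i, D i ≠ 0) → diagonal D ∈ S) (s : Finset α) :
    ∀ M : Matrix ι ι K, (∀ i j, d i ≠ d j → M i j = 0) → M.det ≠ 0 →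
      (∀ i j, d i ∉ s → M i j = (1 : Matrix ι ι K) i j) → M ∈ S := by
  -- This keeps the given ring structure as the one underlying the field: for a residue ring it is
  -- the quotient structure.
  obtain ⟨_, rfl⟩ : ∃ F : Field K, F.toCommRing = inst := ⟨hK.toField, rfl⟩
  induction s using Finset.induction_on with
  | empty =>
    intro M _ _ h
    have : M = 1 := by ext i j; exact h i j (by simp)
    exact this ▸ S.one_mem
  | insert b s hb ih =>
    intro M hM hdet h1
    let e := Equiv.sumCompl fun i => d i = b
    let φ : Matrix _ _ K ≃ₐ[K] Matrix ι ι K := reindexAlgEquiv K K e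
    obtain ⟨M₀, rfl⟩ := φ.surjective M
    have hφ : ∀ (X : Matrix _ _ K) i j, φ X (e i) (e j) = X i j := fun X i j => by simp [φ]
    have hφd : ∀ X : Matrix _ _ K, (φ X).det = X.det := fun X => by simp [φ]
    have hM₀ : M₀ = fromBlocks M₀.toBlocks₁₁ 0 0 1 * fromBlocks 1 0 0 M₀.toBlocks₂₂ := by
      rw [fromBlocks_multiply]
      simp only [Matrix.mul_one, Matrix.one_mul, Matrix.mul_zero, Matrix.zero_mul, add_zero, zero_add]
      conv_lhs => rw [← fromBlocks_toBlocks M₀]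
      congr 1
      · ext i j
        change M₀ (Sum.inl i) (Sum.inr j) = 0
        rw [← hφ M₀, hM]
        simpa [e, i.2] using fun h => j.2 h.symm
      · ext i j
        change M₀ (Sum.inr i) (Sum.inl j) = 0
        rw [← hφ M₀, hM]
        simpa [e, j.2] using i.2
    rw [hφd, hM₀, det_mul, det_fromBlocks_zero₂₁, det_fromBlocks_zero₂₁, det_one, det_one, mul_one,
      one_mul] at hdet
    have hd1 : M₀.toBlocks₁₁.det ≠ 0 := left_ne_zero_of_mul hdet
    have hd2 : M₀.toBlocks₂₂.det ≠ 0 := right_ne_zero_of_mul hdet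
    rw [hM₀, map_mul]
    refine S.mul_mem ?_ (ih _ ?_ ?_ ?_)
    · refine diagonal_transvection_induction_of_det_ne_zero
        (fun N => φ (fromBlocks N 0 0 1) ∈ S) _ hd1 ?_ ?_ ?_
      · intro D hD
        rw [← diagonal_one, fromBlocks_diagonal]
        have : φ (diagonal (Sum.elim D 1)) = diagonal (Sum.elim D 1 ∘ e.symm) := by
          simp [φ, coe_reindexAlgEquiv, Matrix.submatrix_diagonal_equiv]
        change φ (diagonal (Sum.elim D 1)) ∈ S
        rw [this]
        refine hdiag _ fun i => ?_
        rw [det_diagonal, Finset.prod_ne_zero_iff] at hD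
        obtain ⟨i, rfl⟩ := e.surjective i
        rcases i with i | i
        · simpa using hD i (Finset.mem_univ _)
        · simp
      · intro t
        rw [← TransvectionStruct.toMatrix_sumInl, ← TransvectionStruct.toMatrix_reindexEquiv]
        rcases t with ⟨i, j, hij, c⟩
        refine htr _ _ _ ?_ ?_
        · exact fun h => hij (Subtype.ext h)
        · exact i.2.trans j.2.symm
      · intro A B _ _ hA hB
        have : fromBlocks (A * B) 0 0 (1 : Matrix {i // ¬ d i = b} {i // ¬ d i = b} K) =
            fromBlocks A 0 0 1 * fromBlocks B 0 0 1 := by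
          simp [fromBlocks_multiply]
        rw [this, map_mul]
        exact S.mul_mem hA hB
    · intro i j hij
      obtain ⟨i, rfl⟩ := e.surjective i
      obtain ⟨j, rfl⟩ := e.surjective j
      rw [hφ]
      rcases i with i | i <;> rcases j with j | j
      · exact absurd (i.2.trans j.2.symm) hij
      · rfl
      · rfl
      · have := hM _ _ hij
        rwa [hφ] at this
    · rw [hφd, det_fromBlocks_zero₂₁, det_one, one_mul]
      exact hd2
    · intro i j his
      obtain ⟨i, rfl⟩ := e.surjective i
      obtain ⟨j, rfl⟩ := e.surjective j
      have hone : (1 : Matrix ι ι K) (e i) (e j) = (1 : Matrix _ _ K) i j := by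
        simp [Matrix.one_apply]
      rw [hφ, hone]
      rcases i with i | i
      · rw [← fromBlocks_one]
        rcases j with j | j <;> rfl
      · have h2 := h1 (e (Sum.inr i)) (e j) (by
          rw [Finset.mem_insert, not_or]
          exact ⟨i.2, his⟩)
        rw [hφ, hone] at h2
        rw [← h2]
        rcases j with j | j
        · rw [h2]; simp
        · rfl

section
variable {k : ℕ} (d : ι → ZMod k)

/-- A matrix is homogeneous of degree `s` for a grading `d` of the basis. -/
def HasDegree {R : Type*} [CommRing R] (s : ZMod k) (M : Matrix ι ι R) : Prop :=
  ∀ i j, d i ≠ d j + s → M i j = 0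

variable {d}

theorem HasDegree.mul {s t : ZMod k} {M N : Matrix ι ι K} (hM : HasDegree d s M)
    (hN : HasDegree d t N) : HasDegree d (s + t) (M * N) := by
  intro i j hij
  rw [mul_apply]
  refine Finset.sum_eq_zero fun l _ => ?_
  by_cases h : d i = d l + s
  · rw [hN l j, mul_zero]
    rintro h'
    exact hij (by rw [h, h']; ring)
  · rw [hM i l h, zero_mul]

theorem HasDegree.one : HasDegree d 0 (1 : Matrix ι ι K) := by
  intro i j hij
  rw [one_apply_ne]
  rintro rfl
  simp at hij

theorem HasDegree.pow {s : ZMod k} {M : Matrix ι ι K} (hM : HasDegree d s M) (n : ℕ) :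
    HasDegree d (n * s) (M ^ n) := by
  induction n with
  | zero => simpa using HasDegree.one
  | succ n ih =>
    rw [pow_succ]
    convert ih.mul hM using 1
    push_cast
    ring

/-- This is where `k < n` enters: it leaves no room for the centralizer of `y` in degree `0` to
consist of scalars only. -/
theorem exists_commute_ne_scalar (hk : 0 < k) (hcard : k < Fintype.card ι)
    {y : Matrix ι ι K} (hy : HasDegree d (-1) y) :
    ∃ a : Matrix ι ι K, HasDegree d 0 a ∧ a * y = y * a ∧ ∀ c : K, a ≠ c • 1 := by
  have : Nonempty ι := Fintype.card_pos_iff.1 (by omega)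
  by_cases hs : ∃ c : K, y ^ k = c • 1
  swap
  · push Not at hs
    exact ⟨y ^ k, by simpa using hy.pow k, (Commute.refl y).pow_left k, hs⟩
  classical
  have hex : ∃ m, 0 < m ∧ ∃ c : K, y ^ m = c • 1 := ⟨k, hk, hs⟩
  obtain ⟨l, hl⟩ := Nat.exists_eq_add_of_lt (Nat.find_spec hex).1
  rw [zero_add] at hl
  have hlk : l + 1 ≤ k := hl ▸ Nat.find_min' hex ⟨hk, hs⟩
  obtain ⟨c, hc⟩ := hl ▸ (Nat.find_spec hex).2
  -- Zero counts as a scalar, so minimality of `l + 1` excludes `y ^ l = 0` for `l > 0`.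
  have hmin : y ^ l ≠ 0 := by
    intro h0
    rcases Nat.eq_zero_or_pos l with rfl | hl0
    · simp at h0
    · exact Nat.find_min hex (m := l) (by omega) ⟨hl0, 0, by simpa using h0⟩
  obtain ⟨p, q, hpq⟩ : ∃ p q, (y ^ l) p q ≠ 0 := by
    by_contra! h
    exact hmin (by ext i j; exact h i j)
  have hdpq : d p = d q + (l : ZMod k) * (-1) := by
    by_contra h
    exact hpq (hy.pow l p q h)
  let T : ℕ → Matrix ι ι K := fun i => y ^ i * single q p (1 : K) * y ^ (l + 1 - i)
  -- The entry `(y ^ l) p q ≠ 0` forces `E_qp` to have degree `l`, which cancels the degree `-l` of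
  -- the powers of `y`. Both `y * a` and `a * y` are sums of consecutive terms `T i`, differing only
  -- in `T (l + 1)` and `T 0`, which agree because `y ^ (l + 1)` is the scalar `c`.
  let a : Matrix ι ι K := ∑ i ∈ Finset.range (l + 1), y ^ i * single q p (1 : K) * y ^ (l - i)
  have hya : y * a = ∑ i ∈ Finset.range (l + 1), T (i + 1) := by
    rw [Finset.mul_sum]
    refine Finset.sum_congr rfl fun i _ => ?_
    simp only [T, pow_succ' y i, mul_assoc, Nat.add_sub_add_right]
  have hay : a * y = ∑ i ∈ Finset.range (l + 1), T i := by
    rw [Finset.sum_mul]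
    refine Finset.sum_congr rfl fun i hi => ?_
    rw [Finset.mem_range] at hi
    simp only [T, mul_assoc]
    rw [← pow_succ, show l - i + 1 = l + 1 - i by omega]
  have hentry : ∀ (i : ℕ) (u v : ι), (y ^ i * single q p (1 : K) * y ^ (l - i) : Matrix ι ι K) u v =
      (y ^ i) u q * (y ^ (l - i)) p v := by
    intro i u v
    rw [single_eq_single_vecMulVec_single, mul_vecMulVec, vecMulVec_mul, vecMulVec_apply]
    simp
  have ha : ∀ u v, a u v =
      ∑ i ∈ Finset.range (l + 1), (y ^ i) u q * (y ^ (l - i)) p v := by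
    intro u v
    simp only [a]
    rw [Matrix.sum_apply]
    exact Finset.sum_congr rfl fun i _ => hentry i u v
  refine ⟨a, ?_, ?_, ?_⟩
  · intro u v huv
    rw [ha]
    refine Finset.sum_eq_zero fun i hi => ?_
    rw [Finset.mem_range] at hi
    by_cases h : d u = d q + (i : ZMod k) * (-1)
    · rw [hy.pow (l - i) p v, mul_zero]
      intro h'
      apply huv
      rw [Nat.cast_sub (by omega)] at h'
      rw [h]
      linear_combination h' - hdpq
    · rw [hy.pow i u q h, zero_mul]
  · have h := Finset.sum_range_succ' T (l + 1)
    rw [Finset.sum_range_succ, ← hay, ← hya] at h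
    have h0 : T (l + 1) = T 0 := by
      simp [T, hc]
    rw [h0] at h
    exact add_right_cancel h
  · intro c' hc'
    have hc0 : c' ≠ 0 := by
      -- In the `(q, q)` entry only `i = 0` contributes, giving `(y ^ l) p q`: for `0 < i ≤ l < k`,
      -- the degree of `y ^ i` is nonzero modulo `k`, so its diagonal vanishes.
      rintro rfl
      have h1 : a q q = 0 := by rw [hc']; simp
      rw [ha, Finset.sum_eq_single 0] at h1
      · simp [hpq] at h1
      · intro i hi hi0
        rw [Finset.mem_range] at hi
        rw [hy.pow i q q, zero_mul]
        intro h
        have h2 : (i : ZMod k) = 0 := by linear_combination h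
        rw [ZMod.natCast_eq_zero_iff] at h2
        exact absurd (Nat.le_of_dvd (by omega) h2) (by omega)
      · simp
    have h1 : a.rank = Fintype.card ι := by
      refine rank_of_isUnit _ ?_
      rw [hc']
      exact (isUnit_iff_isUnit_det _).2 (by simp [hc0])
    -- Each summand has rank at most one, so `a` factors through a space of dimension `l + 1`, too
    -- small for an invertible scalar.
    have h2 : a = (of fun u (i : Fin (l + 1)) => (y ^ (i : ℕ)) u q) *
        (of fun (i : Fin (l + 1)) v => (y ^ (l - i)) p v) := by
      ext u v
      rw [ha, mul_apply, Finset.sum_range]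
      rfl
    have h3 : a.rank ≤ l + 1 := by
      rw [h2]
      refine (rank_mul_le_left _ _).trans ((rank_le_card_width _).trans ?_)
      simp
    omega

/-- Commuting with `E_ij` equates the diagonal entries at `i` and `j` and kills the off-diagonal
entries of column `i`. As every class occurs, each index has a predecessor of degree one less, and
one walk through chosen representatives of the classes links all diagonal entries. -/
theorem eq_scalar_of_commute_single [NeZero k] (hd : Function.Surjective d) {h : Matrix ι ι K}
    (hh : ∀ i j, d i = d j + 1 → single i j 1 * h = h * single i j 1) : ∃ c : K, h = c • 1 := by
  choose s hs using hd
  have hn : ∀ n : ℕ, h (s n) (s n) = h (s 0) (s 0) := by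
    intro n
    induction n with
    | zero => simp
    | succ n ih =>
      rw [← ih]
      exact diag_eq_of_commute_single (hh _ _ (by simp [hs]))
  refine ⟨h (s 0) (s 0), ?_⟩
  ext i j
  have hi : d i = d (s (d i - 1)) + 1 := by simp [hs]
  rcases eq_or_ne i j with rfl | hij
  · rw [diag_eq_of_commute_single (hh _ _ hi), ← ZMod.natCast_zmod_val (d i - 1), hn]
    simp
  · rw [col_eq_zero_of_commute_single (hh j (s (d j - 1)) (by simp [hs])) hij]
    simp [hij]

end

end GradedMatrices

/-! ### Infinite stabilizers in the graded model -/

section Stabilizers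

open Matrix MoyPrasad

variable {K ι : Type*} [Field K] [Fintype ι] [DecidableEq ι]

/-- The determinant is a polynomial in `t` with value `1` at `t = 0`. -/
theorem finite_det_one_add_smul_eq_zero (a : Matrix ι ι K) :
    {t : K | (1 + t • a).det = 0}.Finite := by
  let P : Polynomial K := (1 + (Polynomial.X : Polynomial K) • a.map Polynomial.C).det
  have hP : ∀ t, P.eval t = (1 + t • a).det := by
    intro t
    simp only [P]
    rw [← Polynomial.coe_evalRingHom, RingHom.map_det]
    congr 1
    ext i j
    simp [Matrix.one_apply, apply_ite]
    exact mul_comm _ _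
  have h0 : P ≠ 0 := by
    intro h
    have := hP 0
    simp [h] at this
  refine (Polynomial.finite_setOfPred_isRoot h0).subset fun t ht => ?_
  rw [Set.mem_ofPred_eq, Polynomial.IsRoot.def, hP]
  exact ht

/-- Abstract form of the main argument: `W` is identified with the matrices of degree `1`, and `G`
acts by conjugation through a homomorphism whose image contains all invertible matrices of degree
`0`. -/
theorem not_finite_stabilizer {K : Type*} [inst : CommRing K] (hK : IsField K) [Infinite K] {G W : Type*} [Group G] [AddCommGroup W] [Module K W]
    (N : Representation K G W) {k : ℕ} [NeZero k] {d : ι → ZMod k} (hd : Function.Surjective d)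
    (hcard : k < Fintype.card ι) (coord : W →ₗ[K] Matrix ι ι K)
    (hinj : Function.Injective coord) (hdeg : ∀ w, HasDegree d 1 (coord w))
    (hsurj : ∀ i j, d i = d j + 1 → ∃ w, coord w = single i j 1)
    (ρ : G →* Matrix ι ι K)
    (hρ : ∀ M : Matrix ι ι K, HasDegree d 0 M → M.det ≠ 0 → ∃ g, ρ g = M)
    (hN : ∀ g w, coord (N g w) = ρ g * coord w * ρ g⁻¹) (lam : Module.Dual K W) :
    ¬ Finite (↥(functionalStabilizer N lam) ⧸
      (MonoidHom.ker N).subgroupOf (functionalStabilizer N lam)) := by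
  obtain ⟨_, rfl⟩ : ∃ F : Field K, F.toCommRing = inst := ⟨hK.toField, rfl⟩
  intro hfin
  have hinv : ∀ g, ρ g⁻¹ * ρ g = 1 := fun g => by rw [← map_mul, inv_mul_cancel, map_one]
  have hinv' : ∀ g, ρ g * ρ g⁻¹ = 1 := fun g => by rw [← map_mul, mul_inv_cancel, map_one]
  have hex : ∀ i j, ∃ w, coord w = if d i = d j + 1 then single i j 1 else 0 := by
    intro i j
    split_ifs with h
    · exact hsurj i j h
    · exact ⟨0, map_zero _⟩
  choose b hb using hex
  -- The transposed indices make `lam` the functional `w ↦ tr(y w)`, with `y` of degree `-1`.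
  let y : Matrix ι ι K := of fun j i => lam (b i j)
  have hy : HasDegree d (-1) y := by
    intro j i hij
    have h0 : b i j = 0 := hinj (by
      rw [hb, if_neg, map_zero]
      intro h
      exact hij (by rw [h]; ring))
    simp [y, h0]
  have hlam : ∀ w, lam w = (y * coord w).trace := by
    intro w
    have hw : w = ∑ i, ∑ j, coord w i j • b i j := by
      refine hinj ?_
      conv_lhs => rw [matrix_eq_sum_single (coord w)]
      simp only [map_sum, map_smul, hb]
      refine Finset.sum_congr rfl fun i _ => Finset.sum_congr rfl fun j _ => ?_
      split_ifs with h
      · simp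
      · simp [hdeg w i j h]
    conv_lhs => rw [hw]
    simp only [map_sum, map_smul, trace, diag_apply, mul_apply, y, of_apply, smul_eq_mul]
    rw [Finset.sum_comm]
    exact Finset.sum_congr rfl fun i _ => Finset.sum_congr rfl fun j _ => mul_comm _ _
  have hstab : ∀ g, ρ g * y = y * ρ g → g ∈ functionalStabilizer N lam := by
    intro g hg
    change N.dual g lam = lam
    ext w
    change lam (N g⁻¹ w) = lam w
    rw [hlam, hlam, hN, inv_inv, ← mul_assoc, trace_mul_comm, ← mul_assoc, ← mul_assoc, hg,
      mul_assoc y, hinv', mul_one]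
  have hker : ∀ g, N g = 1 → ∃ c : K, ρ g = c • 1 := by
    intro g hg
    refine eq_scalar_of_commute_single hd fun i j hij => ?_
    obtain ⟨w, hw⟩ := hsurj i j hij
    have h := hN g w
    rw [hg, Module.End.one_apply, hw] at h
    conv_lhs => rw [h]
    rw [mul_assoc, hinv, mul_one]
  obtain ⟨a, ha0, hay, hns⟩ := exists_commute_ne_scalar (NeZero.pos k) hcard hy
  have hlift : ∀ t : {t : K // (1 + t • a).det ≠ 0}, ∃ g, ρ g = 1 + t.1 • a := by
    intro t
    refine hρ _ (fun i j hij => ?_) t.2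
    simp [ha0 i j hij, HasDegree.one i j hij]
  choose g hg using hlift
  have hgs : ∀ t, g t ∈ functionalStabilizer N lam := fun t => hstab _ (by
    rw [hg]
    simp [add_mul, mul_add, hay])
  have hT : Infinite {t : K // (1 + t • a).det ≠ 0} :=
    (finite_det_one_add_smul_eq_zero a).infinite_compl.to_subtype
  refine not_injective_infinite_finite (fun t => (QuotientGroup.mk (⟨g t, hgs t⟩ :
    functionalStabilizer N lam) : ↥(functionalStabilizer N lam) ⧸
      (MonoidHom.ker N).subgroupOf (functionalStabilizer N lam))) ?_
  intro t s hts
  rw [QuotientGroup.eq, Subgroup.mem_subgroupOf, MonoidHom.mem_ker] at hts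
  obtain ⟨c, hc⟩ := hker _ hts
  have h1 : ρ (g s) = c • ρ (g t) := by
    have : g s = g t * ((g t)⁻¹ * g s) := by group
    rw [this, map_mul]
    change _ * ρ ((g t)⁻¹ * g s) = _
    have hc' : ρ ((g t)⁻¹ * g s) = c • 1 := hc
    rw [hc', mul_smul_comm, mul_one]
  rw [hg, hg, smul_add, smul_smul] at h1
  -- From `1 + s a = c (1 + t a)`: as `a` is not scalar, both coefficients must vanish, so `c = 1`
  -- and `s = t`.
  have h2 : (s.1 - c * t.1) • a = (c - 1) • (1 : Matrix ι ι K) := by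
    rw [sub_smul, sub_smul, one_smul, sub_eq_sub_iff_add_eq_add, add_comm, h1]
  have h3 : s.1 - c * t.1 = 0 := by
    by_contra h
    refine hns ((s.1 - c * t.1)⁻¹ * (c - 1)) ?_
    rw [mul_smul, ← h2, smul_smul, inv_mul_cancel₀ h, one_smul]
  rw [h3, zero_smul] at h2
  have : Nonempty ι := Fintype.card_pos_iff.1 (by omega)
  have h4 : c - 1 = 0 := (smul_eq_zero.1 h2.symm).resolve_right one_ne_zero
  refine Subtype.ext ?_
  linear_combination -h3 - t.1 * h4

end Stabilizers

/-! ### Reduction of the Moy–Prasad lattices to matrices over the residue ring -/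

section Reduction

open Matrix
namespace MoyPrasad

section
variable {O E : Type*} [CommRing O] [Field E] [Algebra O E] {ϖ : O}

open Classical in
/-- The residue class of `z / ϖ ^ m`, for `z` in `𝔭 ^ m`; junk outside of `𝔭 ^ m`. -/
noncomputable def residue (ϖ : O) (m : ℤ) (z : E) : ResRing ϖ :=
  if h : ∃ c : O, algebraMap O E c * algebraMap O E ϖ ^ m = z then
    Ideal.Quotient.mk _ h.choose else 0

variable [IsPseudoUniformizer E ϖ] [FaithfulSMul O E]

theorem residue_apply (m : ℤ) (c : O) :
    residue ϖ m (algebraMap O E c * algebraMap O E ϖ ^ m) = Ideal.Quotient.mk _ c := by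
  have h : ∃ c' : O, algebraMap O E c' * algebraMap O E ϖ ^ m =
    algebraMap O E c * algebraMap O E ϖ ^ m := ⟨c, rfl⟩
  have h0 : algebraMap O E ϖ ^ m ≠ 0 :=
    zpow_ne_zero _ (IsPseudoUniformizer.map_ne_zero (E := E) (ϖ := ϖ))
  rw [residue, dif_pos h]
  congr 1
  exact FaithfulSMul.algebraMap_injective O E (mul_right_cancel₀ h0 h.choose_spec)

theorem residue_add {m : ℤ} {y z : E} (hy : y ∈ fracPow E ϖ m) (hz : z ∈ fracPow E ϖ m) :
    residue ϖ m (y + z) = residue ϖ m y + residue ϖ m z := by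
  obtain ⟨c, rfl⟩ := mem_fracPow.1 hy
  obtain ⟨c', rfl⟩ := mem_fracPow.1 hz
  rw [← add_mul, ← map_add, residue_apply, residue_apply, residue_apply, map_add]

theorem residue_smul {m : ℤ} {z : E} (c : O) (hz : z ∈ fracPow E ϖ m) :
    residue ϖ m (c • z) = Ideal.Quotient.mk _ c * residue ϖ m z := by
  obtain ⟨c', rfl⟩ := mem_fracPow.1 hz
  rw [Algebra.smul_def, ← mul_assoc, ← map_mul, residue_apply, residue_apply, map_mul]

theorem residue_mul {m l : ℤ} {y z : E} (hy : y ∈ fracPow E ϖ m) (hz : z ∈ fracPow E ϖ l) :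
    residue ϖ (m + l) (y * z) = residue ϖ m y * residue ϖ l z := by
  obtain ⟨c, rfl⟩ := mem_fracPow.1 hy
  obtain ⟨c', rfl⟩ := mem_fracPow.1 hz
  have : algebraMap O E c * algebraMap O E ϖ ^ m * (algebraMap O E c' * algebraMap O E ϖ ^ l) =
      algebraMap O E (c * c') * algebraMap O E ϖ ^ (m + l) := by
    rw [zpow_add₀ (IsPseudoUniformizer.map_ne_zero (E := E) (ϖ := ϖ)), map_mul]
    ring
  rw [this, residue_apply, residue_apply, residue_apply, map_mul]

theorem residue_eq_zero_iff {m : ℤ} {z : E} (hz : z ∈ fracPow E ϖ m) :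
    residue ϖ m z = 0 ↔ z ∈ fracPow E ϖ (m + 1) := by
  obtain ⟨c, rfl⟩ := mem_fracPow.1 hz
  have h0 := IsPseudoUniformizer.map_ne_zero (E := E) (ϖ := ϖ)
  rw [residue_apply, Ideal.Quotient.eq_zero_iff_mem, Ideal.mem_span_singleton, mem_fracPow]
  constructor
  · rintro ⟨c', rfl⟩
    exact ⟨c', by rw [zpow_add₀ h0, map_mul, zpow_one]; ring⟩
  · rintro ⟨c', h⟩
    refine ⟨c', FaithfulSMul.algebraMap_injective O E
      (mul_right_cancel₀ (zpow_ne_zero m h0) ?_)⟩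
    rw [← h, zpow_add₀ h0, map_mul, zpow_one]
    ring

theorem residue_zero (m : ℤ) : residue ϖ m (0 : E) = 0 :=
  (residue_eq_zero_iff (Submodule.zero_mem _)).2 (Submodule.zero_mem _)

variable {ι : Type*} [Fintype ι] [DecidableEq ι]

/-- The reduction of a matrix in `𝔤_{x,r}` modulo `𝔤_{x,r+}`, as a matrix over the residue ring. -/
noncomputable def reduction (ϖ : O) (x : ι → ℝ) (r : ℝ) (X : Matrix ι ι E) :
    Matrix ι ι (ResRing ϖ) :=
  of fun i j => if expo x r i j < expoPlus x r i j then residue ϖ (expo x r i j) (X i j) else 0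

theorem reduction_apply (x : ι → ℝ) (r : ℝ) (X : Matrix ι ι E) (i j : ι) :
    reduction ϖ x r X i j =
      if expo x r i j < expoPlus x r i j then residue ϖ (expo x r i j) (X i j) else 0 := rfl

/-- The floor and the ceiling agree exactly at integers. These are the positions `(i, j)` at which
the filtration jumps at depth `r`, that is, those surviving in the quotient. -/
theorem expo_lt_expoPlus_iff (x : ι → ℝ) (r : ℝ) (i j : ι) :
    expo x r i j < expoPlus x r i j ↔ ∃ m : ℤ, x i - x j - r = m := by
  simp only [expo, expoPlus]
  constructor
  · intro h
    have h1 : ⌈x i - x j - r⌉ ≤ ⌊x i - x j - r⌋ := by omega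
    exact ⟨⌊x i - x j - r⌋, le_antisymm ((Int.le_ceil _).trans (by exact_mod_cast h1))
      (Int.floor_le _)⟩
  · rintro ⟨m, hm⟩
    rw [hm, Int.floor_intCast, Int.ceil_intCast]
    omega

theorem expoPlus_eq_of_lt {x : ι → ℝ} {r : ℝ} {i j : ι} (h : expo x r i j < expoPlus x r i j) :
    expoPlus x r i j = expo x r i j + 1 := by
  simp only [expo, expoPlus] at h ⊢
  have := Int.floor_le_ceil (x i - x j - r)
  omega

theorem reduction_add {x : ι → ℝ} {r : ℝ} {X Y : Matrix ι ι E} (hX : X ∈ lie E ϖ x r)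
    (hY : Y ∈ lie E ϖ x r) : reduction ϖ x r (X + Y) = reduction ϖ x r X + reduction ϖ x r Y := by
  ext i j
  simp only [reduction_apply, Matrix.add_apply]
  split_ifs
  · exact residue_add (hX i j) (hY i j)
  · simp

theorem reduction_smul {x : ι → ℝ} {r : ℝ} {X : Matrix ι ι E} (c : O) (hX : X ∈ lie E ϖ x r) :
    reduction ϖ x r (c • X) = Ideal.Quotient.mk (Ideal.span {ϖ}) c • reduction ϖ x r X := by
  ext i j
  simp only [reduction_apply, Matrix.smul_apply]
  split_ifs
  · exact residue_smul c (hX i j)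
  · simp

theorem reduction_eq_zero_iff {x : ι → ℝ} {r : ℝ} {X : Matrix ι ι E} (hX : X ∈ lie E ϖ x r) :
    reduction ϖ x r X = 0 ↔ X ∈ liePlus E ϖ x r := by
  rw [← Matrix.ext_iff]
  refine forall_congr' fun i => forall_congr' fun j => ?_
  rw [reduction_apply, Matrix.zero_apply]
  split_ifs with h
  · rw [residue_eq_zero_iff (hX i j), expoPlus_eq_of_lt h]
  · rw [le_antisymm (not_lt.1 h) (expo_le_expoPlus x r i j)]
    simpa using hX i j

theorem residue_sum {m : ℤ} {α : Type*} (s : Finset α) (z : α → E)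
    (hz : ∀ a ∈ s, z a ∈ fracPow E ϖ m) :
    residue ϖ m (∑ a ∈ s, z a) = ∑ a ∈ s, residue ϖ m (z a) := by
  classical
  induction s using Finset.induction_on with
  | empty => simp [residue_zero]
  | insert a s ha ih =>
    rw [Finset.sum_insert ha, Finset.sum_insert ha, residue_add (hz a (by simp))
      (Submodule.sum_mem _ fun b hb => hz b (by simp [hb])), ih fun b hb => hz b (by simp [hb])]

/-- If `(i, j)` jumps at `r` and `(j, k)` at `s`, then `(i, k)` jumps at `r + s` and the exponents
add exactly. If `(i, k)` jumps but one factor does not, the product gains a power of `ϖ` and reduces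
to zero. -/
theorem reduction_mul {x : ι → ℝ} {r s : ℝ} {X Y : Matrix ι ι E} (hX : X ∈ lie E ϖ x r)
    (hY : Y ∈ lie E ϖ x s) :
    reduction ϖ x (r + s) (X * Y) = reduction ϖ x r X * reduction ϖ x s Y := by
  ext i k
  have hle := fun j => expo_add x (le_refl (r + s)) i j k
  rw [reduction_apply, mul_apply, mul_apply]
  split_ifs with h
  · rw [residue_sum _ _ fun j _ => fracPow_anti (hle j) (fracPow_mul (hX i j) (hY j k))]
    refine Finset.sum_congr rfl fun j _ => ?_
    rw [reduction_apply, reduction_apply]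
    have h1 := expo_add_left x (le_refl (r + s)) i j k
    have h2 := expo_add_right x (le_refl (r + s)) i j k
    have h3 := expo_le_expoPlus x r i j
    have h4 := expo_le_expoPlus x s j k
    have h5 := expoPlus_eq_of_lt h
    have hzero : expo x (r + s) i k + 1 ≤ expo x r i j + expo x s j k →
        residue ϖ (expo x (r + s) i k) (X i j * Y j k) = 0 := fun h =>
      (residue_eq_zero_iff (fracPow_anti (hle j) (fracPow_mul (hX i j) (hY j k)))).2
        (fracPow_anti h (fracPow_mul (hX i j) (hY j k)))
    by_cases h6 : expo x r i j < expoPlus x r i j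
    · by_cases h7 : expo x s j k < expoPlus x s j k
      · rw [if_pos h6, if_pos h7, ← residue_mul (hX i j) (hY j k)]
        congr 1
        rw [expo_lt_expoPlus_iff] at h6 h7
        obtain ⟨a, ha⟩ := h6
        obtain ⟨b, hb⟩ := h7
        have hab : x i - x k - (r + s) = ((a + b : ℤ) : ℝ) := by push_cast; linarith
        simp only [expo, ha, hb, hab, Int.floor_intCast]
        ring
      · rw [if_neg h7, mul_zero]
        exact hzero (by omega)
    · rw [if_neg h6, zero_mul]
      exact hzero (by omega)
  · symm
    refine Finset.sum_eq_zero fun j _ => ?_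
    rw [reduction_apply, reduction_apply]
    by_cases h6 : expo x r i j < expoPlus x r i j
    · by_cases h7 : expo x s j k < expoPlus x s j k
      · exfalso
        apply h
        rw [expo_lt_expoPlus_iff] at h6 h7 ⊢
        obtain ⟨a, ha⟩ := h6
        obtain ⟨b, hb⟩ := h7
        exact ⟨a + b, by push_cast; linarith⟩
      · rw [if_neg h7, mul_zero]
    · rw [if_neg h6, zero_mul]

theorem reduction_one (x : ι → ℝ) : reduction ϖ x 0 (1 : Matrix ι ι E) = 1 := by
  ext i j
  rw [reduction_apply]
  rcases eq_or_ne i j with rfl | h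
  · have h1 : expo x 0 i i = 0 := by simp [expo]
    have h2 : expoPlus x 0 i i = 1 := by simp [expoPlus]
    rw [h1, h2, if_pos one_pos, one_apply_eq, one_apply_eq]
    simpa using residue_apply (E := E) (ϖ := ϖ) 0 1
  · rw [one_apply_ne h, one_apply_ne h, residue_zero, ite_self]

theorem exists_reduction_eq (E : Type*) [Field E] [Algebra O E] [IsPseudoUniformizer E ϖ]
    [FaithfulSMul O E] {x : ι → ℝ} {r : ℝ} {M : Matrix ι ι (ResRing ϖ)}
    (hM : ∀ i j, ¬ expo x r i j < expoPlus x r i j → M i j = 0) :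
    ∃ X ∈ lie E ϖ x r, reduction ϖ x r X = M := by
  choose c hc using fun i j => Ideal.Quotient.mk_surjective (M i j)
  refine ⟨of fun i j => algebraMap O E (c i j) * algebraMap O E ϖ ^ expo x r i j,
    fun i j => mem_fracPow.2 ⟨c i j, rfl⟩, ?_⟩
  ext i j
  rw [reduction_apply]
  split_ifs with h
  · rw [of_apply, residue_apply, hc]
  · exact (hM i j h).symm

theorem reduction_transvection {x : ι → ℝ} {i j : ι} (c : O)
    (h : expo x 0 i j < expoPlus x 0 i j) :
    reduction ϖ x 0 (transvection i j (algebraMap O E c * algebraMap O E ϖ ^ expo x 0 i j)) =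
      transvection i j (Ideal.Quotient.mk (Ideal.span {ϖ}) c) := by
  have hs : single i j (algebraMap O E c * algebraMap O E ϖ ^ expo x 0 i j) ∈ lie E ϖ x 0 := by
    intro k l
    rw [single_apply]
    split_ifs with h
    · rw [← h.1, ← h.2]
      exact mem_fracPow.2 ⟨c, rfl⟩
    · exact Submodule.zero_mem _
  rw [transvection, reduction_add one_mem_lie hs, reduction_one, transvection]
  congr 1
  ext k l
  rw [reduction_apply, single_apply, single_apply]
  by_cases hkl : i = k ∧ j = l
  · obtain ⟨rfl, rfl⟩ := hkl
    rw [if_pos h, if_pos ⟨rfl, rfl⟩, if_pos ⟨rfl, rfl⟩, residue_apply]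
  · rw [if_neg hkl, if_neg hkl, residue_zero, ite_self]

theorem reduction_diagonal (x : ι → ℝ) (c : ι → O) :
    reduction ϖ x 0 (diagonal fun i => algebraMap O E (c i)) =
      diagonal fun i => Ideal.Quotient.mk (Ideal.span {ϖ}) (c i) := by
  ext i j
  rw [reduction_apply]
  rcases eq_or_ne i j with rfl | h
  · have h1 : expo x 0 i i = 0 := by simp [expo]
    have h2 : expoPlus x 0 i i = 1 := by simp [expoPlus]
    rw [h1, h2, if_pos one_pos, diagonal_apply_eq, diagonal_apply_eq]
    simpa using residue_apply (E := E) (ϖ := ϖ) 0 (c i)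
  · rw [diagonal_apply_ne _ h, diagonal_apply_ne _ h, residue_zero, ite_self]

end
end MoyPrasad

end Reduction

/-! ### `G_x` and `V_x` as graded matrices -/

section MoyPrasadQuotients

open Matrix
namespace MoyPrasad

section
variable {O : Type*} (E : Type*) {ι : Type*} [CommRing O] [Field E] [Algebra O E] [Fintype ι]
  [DecidableEq ι] (ϖ : O) [IsPseudoUniformizer E ϖ] [FaithfulSMul O E]

/-- The reduction map on `𝔤_{x,r}`. -/
noncomputable def reductionHom (x : ι → ℝ) (r : ℝ) :
    lie E ϖ x r →ₗ[O] Matrix ι ι (ResRing ϖ) where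
  toFun X := reduction ϖ x r X.1
  map_add' X Y := reduction_add X.2 Y.2
  map_smul' c X := reduction_smul c X.2

/-- The coordinates on `V_{x,r}` given by the reduction map. -/
noncomputable def coordV (x : ι → ℝ) (r : Set.Ioi (0 : ℝ)) :
    V E ϖ x r →ₗ[ResRing ϖ] Matrix ι ι (ResRing ϖ) where
  toFun v := Submodule.liftQ _ (reductionHom E ϖ x r)
    (fun X hX => (reduction_eq_zero_iff X.2).2 hX) (vEquiv E ϖ x r v)
  map_add' v w := by rw [map_add, map_add]
  map_smul' c v := by
    obtain ⟨c, rfl⟩ := Ideal.Quotient.mk_surjective c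
    rw [vEquiv_smul]
    exact map_smul (Submodule.liftQ _ (reductionHom E ϖ x r) _) c _

theorem coordV_mk (x : ι → ℝ) (r : Set.Ioi (0 : ℝ)) (g : filt E ϖ x r) :
    coordV E ϖ x r (Multiplicative.toAdd (V.mk E ϖ x r g)) =
      reduction ϖ x r (((g : GL ι E) : Matrix ι ι E) - 1) := rfl

theorem coordV_injective (x : ι → ℝ) (r : Set.Ioi (0 : ℝ)) :
    Function.Injective (coordV E ϖ x r) := by
  rw [injective_iff_map_eq_zero]
  intro v hv
  obtain ⟨g, rfl⟩ := V.mk_surjective E ϖ x r v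
  rw [coordV_mk, reduction_eq_zero_iff ((mem_filt_iff r.2).1 g.2),
    ← mem_filtPlus_iff (le_of_lt r.2)] at hv
  change Additive.ofMul (QuotientGroup.mk g) = Additive.ofMul 1
  rw [(QuotientGroup.eq_one_iff g).2 hv]

theorem exists_coordV_eq {x : ι → ℝ} {r : Set.Ioi (0 : ℝ)} {M : Matrix ι ι (ResRing ϖ)}
    (hM : ∀ i j, ¬ expo x r i j < expoPlus x r i j → M i j = 0) :
    ∃ v, coordV E ϖ x r v = M := by
  obtain ⟨X, hX, rfl⟩ := exists_reduction_eq E hM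
  obtain ⟨g, hg, h⟩ := exists_filt r.2 hX
  refine ⟨Multiplicative.toAdd (V.mk E ϖ x r ⟨g, hg⟩), ?_⟩
  rw [coordV_mk, h, add_sub_cancel_left]

/-- The reduction homomorphism on `G_{x,0}`. -/
noncomputable def filtReduction (x : ι → ℝ) : filt E ϖ x 0 →* Matrix ι ι (ResRing ϖ) where
  toFun g := reduction ϖ x 0 ((g : GL ι E) : Matrix ι ι E)
  map_one' := reduction_one x
  map_mul' g h := by
    have := reduction_mul (mem_lie_of_mem_filt_zero g.2).1 (mem_lie_of_mem_filt_zero h.2).1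
    rwa [add_zero] at this

theorem filtReduction_eq_one {x : ι → ℝ} {g : filt E ϖ x 0}
    (hg : g ∈ (filtPlus E ϖ x 0).subgroupOf (filt E ϖ x 0)) : filtReduction E ϖ x g = 1 := by
  rw [Subgroup.mem_subgroupOf, mem_filtPlus_iff le_rfl] at hg
  have h := (reduction_eq_zero_iff (liePlus_le_lie hg)).2 hg
  have h2 := reduction_add (one_mem_lie (x := x)) (liePlus_le_lie hg)
  rw [add_sub_cancel, h, reduction_one, add_zero] at h2
  exact h2

/-- The reduction homomorphism on `G_x`. -/
noncomputable def redQuotReduction (x : ι → ℝ) : RedQuot E ϖ x →* Matrix ι ι (ResRing ϖ) :=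
  QuotientGroup.lift _ (filtReduction E ϖ x) fun _ hg => filtReduction_eq_one E ϖ hg

/-- Conjugation sends `1 + X` to `1 + g X g⁻¹`, and reduction is multiplicative for the depths `0`,
`r`, `0`. -/
theorem coordV_moyPrasadRep (x : ι → ℝ) (r : Set.Ioi (0 : ℝ)) (g : RedQuot E ϖ x)
    (v : V E ϖ x r) : coordV E ϖ x r (moyPrasadRep E ϖ x r g v) =
      redQuotReduction E ϖ x g * coordV E ϖ x r v * redQuotReduction E ϖ x g⁻¹ := by
  obtain ⟨g, rfl⟩ := QuotientGroup.mk_surjective g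
  obtain ⟨h, rfl⟩ := V.mk_surjective E ϖ x r v
  change coordV E ϖ x r (conjV x r g (Multiplicative.toAdd (V.mk E ϖ x r h))) =
    filtReduction E ϖ x g * _ * filtReduction E ϖ x g⁻¹
  rw [conjV_mk, coordV_mk, coordV_mk]
  change reduction ϖ x r ((↑((g : GL ι E) * h * (g : GL ι E)⁻¹) : Matrix ι ι E) - 1) = _
  rw [conj_sub_one]
  have hh := (mem_filt_iff r.2).1 h.2
  obtain ⟨h1, h2⟩ := mem_lie_of_mem_filt_zero g.2
  have e1 := reduction_mul h1 hh
  have e2 := reduction_mul (lie_mul le_rfl h1 hh) h2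
  rw [e1, zero_add, add_zero] at e2
  exact e2

variable {ϖ}

theorem exists_unit_of_isUnit (hϖ : ∀ c : O, IsUnit (1 + ϖ * c)) {a : ResRing ϖ} (ha : IsUnit a) :
    ∃ u : Oˣ, Ideal.Quotient.mk (Ideal.span {ϖ}) u = a := by
  obtain ⟨b, hb⟩ := ha.exists_right_inv
  obtain ⟨c, rfl⟩ := Ideal.Quotient.mk_surjective a
  obtain ⟨c', rfl⟩ := Ideal.Quotient.mk_surjective b
  rw [← map_mul, ← map_one (Ideal.Quotient.mk (Ideal.span {ϖ})), Ideal.Quotient.eq,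
    Ideal.mem_span_singleton] at hb
  obtain ⟨z, hz⟩ := hb
  have h := hϖ z
  rw [← hz, add_sub_cancel] at h
  exact ⟨(isUnit_of_mul_isUnit_left h).unit, rfl⟩

/-- Transvections within a block and invertible diagonal matrices generate the block diagonal group,
and both lift to the defining generators of `G_{x,0}`. -/
theorem exists_redQuotReduction_eq (hR : IsField (ResRing ϖ)) {α : Type*} [DecidableEq α]
    {d : ι → α} {x : ι → ℝ} (hd : ∀ i j, expo x 0 i j < expoPlus x 0 i j ↔ d i = d j)
    {M : Matrix ι ι (ResRing ϖ)} (hM : ∀ i j, d i ≠ d j → M i j = 0) (hdet : M.det ≠ 0) :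
    ∃ g, redQuotReduction E ϖ x g = M := by
  suffices h : M ∈ MonoidHom.mrange (filtReduction E ϖ x) by
    obtain ⟨g, rfl⟩ := h
    exact ⟨QuotientGroup.mk g, rfl⟩
  refine mem_of_blockDiagonal hR d _ ?_ ?_ (Finset.univ.image d) M hM hdet ?_
  · intro i j c hij hdij
    obtain ⟨c, rfl⟩ := Ideal.Quotient.mk_surjective c
    set u : E := algebraMap O E c * algebraMap O E ϖ ^ expo x 0 i j with hu
    let t : GL ι E := ⟨transvection i j u, transvection i j (-u),
      by rw [transvection_mul_transvection_same _ _ hij]; simp,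
      by rw [transvection_mul_transvection_same _ _ hij]; simp⟩
    have ht : t ∈ filt E ϖ x 0 := Subgroup.subset_closure
      (Or.inr ⟨i, j, hij, u, mem_fracPow.2 ⟨c, rfl⟩, rfl⟩)
    exact ⟨⟨t, ht⟩, reduction_transvection c ((hd i j).2 hdij)⟩
  · intro D hD
    have hu : ∀ i, IsUnit (D i) := fun i => by
      obtain ⟨b, hb⟩ := hR.mul_inv_cancel (hD i)
      exact .of_mul_eq_one b hb
    choose u hu using fun i =>
      exists_unit_of_isUnit (IsPseudoUniformizer.isUnit_one_add_mul E (ϖ := ϖ)) (hu i)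
    have hv : ∀ i, algebraMap O E (u i) * algebraMap O E ↑(u i)⁻¹ = 1 := fun i => by
      rw [← map_mul, Units.mul_inv, map_one]
    let t : GL ι E :=
      ⟨diagonal fun i => algebraMap O E (u i), diagonal fun i => algebraMap O E ↑(u i)⁻¹,
        by rw [diagonal_mul_diagonal, ← diagonal_one]; exact congrArg diagonal (funext hv),
        by
          rw [diagonal_mul_diagonal, ← diagonal_one]
          exact congrArg diagonal (funext fun i => (mul_comm _ _).trans (hv i))⟩
    have ht : t ∈ filt E ϖ x 0 := Subgroup.subset_closure (Or.inl ⟨u, fun i => by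
      rw [Int.ceil_zero, ← map_one (algebraMap O E), ← map_sub]
      exact algebraMap_mem_fracPow _, rfl⟩)
    refine ⟨⟨t, ht⟩, (reduction_diagonal x fun i => (u i : O)).trans ?_⟩
    simp only [hu]
  · intro i j hi
    exact absurd (Finset.mem_image_of_mem d (Finset.mem_univ i)) hi

theorem not_isStable_of_grading (hR : IsField (ResRing ϖ)) [Infinite (ResRing ϖ)] {k : ℕ}
    [NeZero k] {d : ι → ZMod k} (hd : Function.Surjective d) (hcard : k < Fintype.card ι)
    {x : ι → ℝ} {r : Set.Ioi (0 : ℝ)}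
    (hd0 : ∀ i j, expo x 0 i j < expoPlus x 0 i j ↔ d i = d j)
    (hdr : ∀ i j, expo x r i j < expoPlus x r i j ↔ d i = d j + 1)
    (lam : Module.Dual (ResRing ϖ) (V E ϖ x r)) : ¬ IsStable (moyPrasadRep E ϖ x r) lam := by
  intro h
  refine not_finite_stabilizer hR (moyPrasadRep E ϖ x r) hd hcard (coordV E ϖ x r)
    (coordV_injective E ϖ x r) ?_ ?_ (redQuotReduction E ϖ x) ?_ (coordV_moyPrasadRep E ϖ x r) lam
    h.finite_stabilizer
  · intro v i j hij
    obtain ⟨g, rfl⟩ := V.mk_surjective E ϖ x r v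
    rw [coordV_mk, reduction_apply, if_neg fun h => hij ((hdr i j).1 h)]
  · intro i j hij
    refine exists_coordV_eq E ϖ fun a b hab => single_apply_of_ne _ _ _ _ _ ?_
    rintro ⟨rfl, rfl⟩
    exact hab ((hdr _ _).2 hij)
  · intro M hM hdet
    exact exists_redQuotReduction_eq E hR hd0 (fun i j hij => hM i j (by simpa using hij)) hdet

end
end MoyPrasad

end MoyPrasadQuotients

/-! ### The grading attached to a barycenter, and the theorem -/

namespace MoyPrasad

/-- A barycenter of a proper facet, in coordinates: up to translation, all the `x i` are integral
multiples of `1 / k`, and every class modulo `k` occurs. -/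
theorem exists_grading_of_isBarycenter {n : ℕ} {𝓕 : Set (Fin n → ℝ)} (h𝓕 : IsProperFacet 𝓕)
    {x : Fin n → ℝ} (hx : IsBarycenter 𝓕 x) :
    ∃ (k : ℕ) (c : Fin n → ℕ), 0 < k ∧ k < n ∧ (∀ i j, x i - x j = ((c j : ℝ) - c i) / k) ∧
      (∀ m < k, ∃ i, c i = m) ∧ ∃ i, simpleAffineRoot i x = 1 / k := by
  classical
  obtain ⟨⟨-, J, hJ⟩, hne⟩ := h𝓕
  have hxJ := hJ ▸ hx.1
  obtain ⟨i₀, hi₀⟩ : ∃ i, simpleAffineRoot i x = 0 := by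
    by_contra! h
    refine hne ?_
    have hJ0 : J = ∅ := Set.eq_empty_of_forall_notMem fun i hi => h i (hxJ.1 i hi)
    rw [hJ, hJ0]
    ext y
    simp [alcove]
  have hn : 0 < n := i₀.pos
  -- The positions of the nonvanishing simple affine roots; natural numbers are used so that the
  -- count `C` below also makes sense at `n`, where it gives `k`.
  let S : Finset ℕ := (Finset.range n).filter fun t =>
    ∃ h : t < n, simpleAffineRoot ⟨t, h⟩ x ≠ 0
  obtain ⟨s, hs⟩ : ∃ s : ℝ, ∀ i : Fin n, simpleAffineRoot i x = if (i : ℕ) ∈ S then s else 0 := by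
    have hmem : ∀ i : Fin n, (i : ℕ) ∈ S ↔ simpleAffineRoot i x ≠ 0 := fun i => by
      simp [S, i.2]
    by_cases h : ∃ i : Fin n, simpleAffineRoot i x ≠ 0
    · obtain ⟨i, hi⟩ := h
      refine ⟨simpleAffineRoot i x, fun j => ?_⟩
      split_ifs with hj
      · exact hx.2 j i ((hmem j).1 hj) hi
      · exact not_not.1 fun h => hj ((hmem j).2 h)
    · push Not at h
      exact ⟨0, fun i => by simp [h i]⟩
  let C : ℕ → ℕ := fun t => (S.filter (· < t)).card
  have hC0 : C 0 = 0 := by simp [C]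
  have hC1 : ∀ t, C (t + 1) = C t + if t ∈ S then 1 else 0 := by
    intro t
    have : S.filter (· < t + 1) = S.filter (· < t) ∪ if t ∈ S then {t} else ∅ := by
      ext a
      split_ifs with h
      · simp only [Finset.mem_filter, Finset.mem_union, Finset.mem_singleton]
        constructor
        · rintro ⟨h1, h2⟩
          rcases Nat.lt_succ_iff_lt_or_eq.1 h2 with h3 | h3
          · exact Or.inl ⟨h1, h3⟩
          · exact Or.inr h3
        · rintro (⟨h1, h2⟩ | rfl)
          · exact ⟨h1, by omega⟩
          · exact ⟨h, by omega⟩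
      · simp only [Finset.mem_filter, Finset.union_empty]
        refine and_congr_right fun h1 => ?_
        have : a ≠ t := fun h2 => h (h2 ▸ h1)
        omega
    simp only [C]
    rw [this, Finset.card_union_of_disjoint]
    · split_ifs <;> simp
    · split_ifs <;> simp
  have hxC : ∀ t (ht : t < n), x ⟨0, hn⟩ - x ⟨t, ht⟩ = s * C t := by
    intro t
    induction t with
    | zero => intro _; simp [hC0]
    | succ t ih =>
      intro ht
      have h1 := hs ⟨t, by omega⟩
      rw [simpleAffineRoot, dif_pos ht] at h1
      have h2 := ih (by omega)
      rw [hC1]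
      push_cast
      simp only at h1
      split_ifs at h1 ⊢ <;> linarith
  -- The simple affine roots add up to `1`: the last one closes the telescoping sum of the others.
  have hCn : s * C n = 1 := by
    have h1 := hs ⟨n - 1, by omega⟩
    rw [simpleAffineRoot, dif_neg (by simp; omega), hxC] at h1
    have h2 := hC1 (n - 1)
    rw [Nat.sub_add_cancel hn] at h2
    rw [h2]
    push_cast
    simp only at h1
    split_ifs at h1 ⊢ <;> linarith
  have hk0 : C n ≠ 0 := fun h => by simp [h] at hCn
  have hkR : (C n : ℝ) ≠ 0 := by exact_mod_cast hk0
  have hsk : s = 1 / C n := by rw [eq_div_iff hkR, hCn]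
  have hkn : C n < n := by
    have hss : S.filter (· < n) ⊂ Finset.range n := by
      refine (Finset.ssubset_iff_of_subset ?_).2 ⟨i₀, Finset.mem_range.2 i₀.2, ?_⟩
      · exact (Finset.filter_subset _ _).trans (Finset.filter_subset _ _)
      · simp [S, hi₀]
    simpa using Finset.card_lt_card hss
  refine ⟨C n, fun i => C i, Nat.pos_of_ne_zero hk0, hkn, fun i j => ?_, fun m hm => ?_, ?_⟩
  · have h1 := hxC i i.2
    have h2 := hxC j j.2
    rw [hsk] at h1 h2
    rw [sub_div]
    simp only [Fin.eta] at h1 h2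
    have e : ∀ a : ℝ, 1 / (C n : ℝ) * a = a / C n := fun a => by ring
    rw [e] at h1 h2
    linarith
  -- `C` climbs from `0` to `k` by steps of `0` or `1`, so it equals `m` just before it first
  -- exceeds `m`.
  · have hex : ∃ t, m < C t := ⟨n, hm⟩
    have hle : Nat.find hex ≤ n := Nat.find_min' hex hm
    have hpos : Nat.find hex ≠ 0 := fun h => by
      have := Nat.find_spec hex
      rw [h, hC0] at this
      omega
    obtain ⟨t, ht⟩ := Nat.exists_eq_succ_of_ne_zero hpos
    have h1 : ¬ m < C t := Nat.find_min hex (by omega)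
    have h2 : m < C (t + 1) := by
      have := Nat.find_spec hex
      rwa [ht] at this
    rw [hC1] at h2
    refine ⟨⟨t, by omega⟩, ?_⟩
    change C t = m
    split_ifs at h2 <;> omega
  · obtain ⟨t, ht⟩ := Finset.card_pos.1 (Nat.pos_of_ne_zero hk0)
    rw [Finset.mem_filter] at ht
    exact ⟨⟨t, ht.2⟩, by rw [hs, if_pos ht.1, hsk]⟩

/-- For `n = 1` the only simple affine root is the constant `1`, which is not an affine root; hence
the bound on `n`. -/
theorem simpleAffineRoot_mem_affineRoots {n : ℕ} (hn : 1 < n) (i : Fin n) :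
    simpleAffineRoot i ∈ affineRoots n := by
  by_cases h : (i : ℕ) + 1 < n
  · refine ⟨i, ⟨i + 1, h⟩, 0, fun e => by simpa using congrArg Fin.val e, ?_⟩
    funext x
    simp [simpleAffineRoot, h]
  · refine ⟨i, ⟨0, i.pos⟩, 1, fun e => ?_, ?_⟩
    · have := congrArg Fin.val e
      simp only at this
      omega
    · funext x
      simp only [simpleAffineRoot, h, dif_neg, not_false_eq_true, Int.cast_one]
      ring

/-- All affine roots take values in `(1 / k) ℤ` at `x`, and some simple one takes the value `1 / k`.
-/
theorem isLeast_positiveValues_eq {n k : ℕ} {x : Fin n → ℝ} {c : Fin n → ℕ} (hk : 0 < k)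
    (hkn : k < n) (hxc : ∀ i j, x i - x j = ((c j : ℝ) - c i) / k)
    (hi : ∃ i, simpleAffineRoot i x = 1 / k) {r : ℝ} (hr : IsLeast (positiveValues x) r) :
    r = 1 / k := by
  have hkR : (0 : ℝ) < k := by exact_mod_cast hk
  refine le_antisymm ?_ ?_
  · obtain ⟨i, hi⟩ := hi
    exact hr.2 ⟨by positivity, _, simpleAffineRoot_mem_affineRoots (by omega) i, hi⟩
  · obtain ⟨hr0, _, ⟨i, j, m, -, rfl⟩, rfl⟩ := hr.1
    have e : x i - x j + m = ((c j - c i + m * k : ℤ) : ℝ) / k := by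
      rw [hxc]
      push_cast
      field_simp
    simp only [e] at hr0 ⊢
    rw [div_pos_iff_of_pos_right hkR] at hr0
    refine div_le_div_of_nonneg_right ?_ hkR.le
    have : (0 : ℤ) < c j - c i + m * k := by exact_mod_cast hr0
    exact_mod_cast this

theorem expo_lt_expoPlus_iff_of_grading {n k : ℕ} {x : Fin n → ℝ} {c : Fin n → ℕ} (hk : 0 < k)
    (hxc : ∀ i j, x i - x j = ((c j : ℝ) - c i) / k) (a : ℤ) (i j : Fin n) :
    expo x (a / k : ℝ) i j < expoPlus x (a / k : ℝ) i j ↔ -(c i : ZMod k) = -(c j : ZMod k) + a := by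
  have hkR : (k : ℝ) ≠ 0 := by exact_mod_cast hk.ne'
  rw [expo_lt_expoPlus_iff, hxc]
  have h1 : -(c i : ZMod k) = -(c j : ZMod k) + a ↔ ((c j - c i - a : ℤ) : ZMod k) = 0 := by
    push_cast
    constructor <;> intro h <;> linear_combination h
  rw [h1, ZMod.intCast_zmod_eq_zero_iff_dvd]
  refine exists_congr fun m => ?_
  rw [← sub_div, div_eq_iff hkR, mul_comm (m : ℝ)]
  norm_cast

end MoyPrasad

theorem theorem4p4 (F : Type*) [Field F] [CharZero F] [ValuativeRel F] [TopologicalSpace F]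
    [IsNonarchimedeanLocalField F] (ϖ : 𝒪[F]) [Fact (Irreducible ϖ)] (n : ℕ)
    (𝓕 : Set (Fin n → ℝ)) (h𝓕 : MoyPrasad.IsProperFacet 𝓕)
    (x : Fin n → ℝ) (hx : MoyPrasad.IsBarycenter 𝓕 x)
    (r : Set.Ioi (0 : ℝ)) (hr : IsLeast (MoyPrasad.positiveValues x) (r : ℝ)) :
    ¬ ∃ lam : Module.Dual (MoyPrasad.ResRing (MoyPrasad.unif ϖ))
        (MoyPrasad.V (MoyPrasad.FUn F) (MoyPrasad.unif ϖ) x r),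
      MoyPrasad.IsStable
        (MoyPrasad.moyPrasadRep (MoyPrasad.FUn F) (MoyPrasad.unif ϖ) x r) lam := by
  rintro ⟨lam, h⟩
  have hϖ : Irreducible ϖ := Fact.out
  obtain ⟨k, c, hk, hkn, hxc, hc, hi⟩ := MoyPrasad.exists_grading_of_isBarycenter h𝓕 hx
  have hrk := MoyPrasad.isLeast_positiveValues_eq hk hkn hxc hi hr
  have : NeZero k := ⟨hk.ne'⟩
  have := MoyPrasad.infinite_resRing hϖ
  have key := MoyPrasad.expo_lt_expoPlus_iff_of_grading hk hxc
  refine MoyPrasad.not_isStable_of_grading (MoyPrasad.FUn F) (MoyPrasad.isField_resRing hϖ)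
    -- The sign appears because `x i` decreases as `c i` grows; with it, depth `a / k` corresponds
    -- to degree `a`, and the cases `a = 0` and `a = 1` give `G_x` and `V_x`.
    (d := fun i => -(c i : ZMod k)) ?_ (by simpa using hkn) (fun i j => ?_) (fun i j => ?_) lam h
  · intro a
    obtain ⟨i, hi⟩ := hc (-a).val (ZMod.val_lt _)
    exact ⟨i, by simp [hi]⟩
  · simpa using key 0 i j
  · simpa [hrk] using key 1 i j
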